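/- Let $Q\subset\mathbb{R}^2$ be a lattice polygon, that is, a two-dimensional polytope whose vertices lie in $\mathbb{Z}^2$, and let $P\subset\mathbb{R}^2$ be a nonempty lattice polytope (a lattice point, a lattice segment or a lattice polygon) that is a weak Minkowski summand of $Q$, meaning that the normal fan of $Q$ refines the normal fan of $P$. Then the Cayley sum $$\operatorname{Cay}(P,Q):=\operatorname{conv}\bigl(P\times\{0\}\,\cup\,Q\times\{1\}\bigr)\subset\mathbb{R}^3$$ has a unimodular cover: it is equal to the union of a collection of unimodular simplices, where a unimodular simplex in $\mathbb{R}^3$ is the convex hull of four points of $\mathbb{Z}^3$ whose edge vectors from one of them form a basis of the lattice $\mathbb{Z}^3$. Consequently, the pair $(P,Q)$ has the integer decomposition property (is IDP): $$(P+Q)\cap\mathbb{Z}^2=(P\cap\mathbb{Z}^2)+(Q\cap\mathbb{Z}^2).$$ -/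

import Mathlib

open scoped Pointwise

/-- The lattice `ℤ^d` inside `ℝ^d`. -/
def latticePoints (d : ℕ) : Set (Fin d → ℝ) :=
  Set.range fun (z : Fin d → ℤ) (i : Fin d) => (z i : ℝ)

/-- A lattice polytope in `ℝ^d`: the convex hull of a nonempty finite set of lattice points
(of any dimension; a single lattice point is allowed). -/
def IsLatticePolytope {d : ℕ} (P : Set (Fin d → ℝ)) : Prop :=
  ∃ S : Set (Fin d → ℝ), S.Finite ∧ S.Nonempty ∧ S ⊆ latticePoints d ∧ P = convexHull ℝ S

/-- A lattice polygon: a lattice polytope of affine dimension two. -/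
def IsLatticePolygon {d : ℕ} (Q : Set (Fin d → ℝ)) : Prop :=
  IsLatticePolytope Q ∧ Module.finrank ℝ (vectorSpan ℝ Q) = 2

/-- The (outer) normal cone of `F ⊆ P`: the linear functionals that attain their maximum over `P`
at every point of `F`. -/
def normalCone {d : ℕ} (P F : Set (Fin d → ℝ)) : Set (StrongDual ℝ (Fin d → ℝ)) :=
  {l | ∀ x ∈ F, ∀ y ∈ P, l y ≤ l x}

/-- The normal fan of a polytope: the collection of the normal cones of its nonempty faces
(every nonempty face of a polytope is exposed; `P` itself is one of them). -/
def normalFan {d : ℕ} (P : Set (Fin d → ℝ)) : Set (Set (StrongDual ℝ (Fin d → ℝ))) :=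
  {C | ∃ F : Set (Fin d → ℝ), F.Nonempty ∧ IsExposed ℝ P F ∧ C = normalCone P F}

/-- A fan `𝓐` refines a fan `𝓑`: they have the same support, and every cone of `𝓐` is contained
in a cone of `𝓑`. -/
def FanRefines {V : Type*} (𝓐 𝓑 : Set (Set V)) : Prop :=
  ⋃₀ 𝓐 = ⋃₀ 𝓑 ∧ ∀ A ∈ 𝓐, ∃ B ∈ 𝓑, A ⊆ B

/-- `P` is a weak Minkowski summand of `Q`: the normal fan of `Q` refines that of `P`. -/
def IsWeakMinkowskiSummand {d : ℕ} (P Q : Set (Fin d → ℝ)) : Prop :=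
  FanRefines (normalFan Q) (normalFan P)

/-- The Cayley sum `conv (P × {0} ∪ Q × {1}) ⊆ ℝ^(d+1)`. -/
def cayleySum {d : ℕ} (P Q : Set (Fin d → ℝ)) : Set (Fin (d + 1) → ℝ) :=
  convexHull ℝ
    ((fun x : Fin d → ℝ => (Fin.snoc x 0 : Fin (d + 1) → ℝ)) '' P ∪
      (fun x : Fin d → ℝ => (Fin.snoc x 1 : Fin (d + 1) → ℝ)) '' Q)

/-- A (full-dimensional) unimodular simplex in `ℝ^d`: the convex hull of lattice points
`v 0, …, v d` such that the edge vectors `v 1 - v 0, …, v d - v 0` form a basis of `ℤ^d`. -/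
def IsUnimodularSimplex {d : ℕ} (T : Set (Fin d → ℝ)) : Prop :=
  ∃ (v : Fin (d + 1) → Fin d → ℤ) (b : Module.Basis (Fin d) ℤ (Fin d → ℤ)),
    (∀ i : Fin d, v i.succ - v 0 = b i) ∧
      T = convexHull ℝ (Set.range fun (k : Fin (d + 1)) (i : Fin d) => (v k i : ℝ))

/-- `P` has a unimodular cover: it is the union of a collection of unimodular simplices. -/
def HasUnimodularCover {d : ℕ} (P : Set (Fin d → ℝ)) : Prop :=
  ∃ 𝒯 : Set (Set (Fin d → ℝ)), (∀ T ∈ 𝒯, IsUnimodularSimplex T) ∧ ⋃₀ 𝒯 = P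

/-- The pair `(P, Q)` has the integer decomposition property:
`(P + Q) ∩ ℤ^d = P ∩ ℤ^d + Q ∩ ℤ^d`. -/
def IsIDPPair {d : ℕ} (P Q : Set (Fin d → ℝ)) : Prop :=
  (P + Q) ∩ latticePoints d = P ∩ latticePoints d + Q ∩ latticePoints d

/-! A point of the Cayley sum at height `t` is `(1 - t) • p + t • q` with `p ∈ P`, `q ∈ Q`. Slicing
at height `t` turns lattice tetrahedra into weighted sums of a point and a triangle, a triangle and
a point, or two segments. The normalized volume is the area of the triangle in the first two cases
and `|cross (p₂ - p₁) (q₂ - q₁)|` in the mixed case, so everything reduces to descents on planar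
cross products.

Triangles are refined by lattice points they contain (`exists_unimodular_triangle`). The heart is
the mixed descent, `exists_strip_point`: if `D = |cross u v| ≥ 2` for `u = p₂ - p₁`, `v = q₂ - q₁`,
then `P` has a lattice point strictly inside the strip over `[p₁, p₂]` in direction `v`, or `Q` has
one strictly inside the strip over `[q₁, q₂]` in direction `u`. Suppose not. An edge of `P` crosses
its strip (`exists_edge_across`); the fan hypothesis yields an edge of `Q` with the same outer
normal (`IsWeakMinkowskiSummand.exists_two_maximizers`). That edge must lie beyond `q₂`, and there
it forces a chord of `Q` equal to a translate of `[0, u]` (`exists_chord_of_free`). By symmetry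
there is such a chord beyond `q₁`. Convexity then gives a chord of the same length on the lattice
line next to `q₁`, and this chord contains a lattice point.

The new point need not lie in the old cell. The exchange lemmas `exchange_cut` and
`exchange_segment` therefore use that a weighted sum is unchanged when a displacement is transferred
between the summands: sliding ends in a smaller mixed cell, or with one summand at a lattice point.

The decomposition property follows by looking at height `1/2`: barycentric coordinates of a doubled
lattice point in a unimodular simplex are integers. -/

/-! ### Cross products and lattice vectors in the plane -/

/-- The planar cross product `x 0 * y 1 - x 1 * y 0`. -/
def cross {R : Type*} [CommRing R] (x y : Fin 2 → R) : R := x 0 * y 1 - x 1 * y 0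

/-- The inclusion of `ℤ^d` into `ℝ^d`. -/
def castVec {d : ℕ} (z : Fin d → ℤ) : Fin d → ℝ := fun i => (z i : ℝ)

theorem castVec_sub {d : ℕ} (x y : Fin d → ℤ) : castVec (x - y) = castVec x - castVec y := by
  ext i; simp [castVec]

theorem castVec_add {d : ℕ} (x y : Fin d → ℤ) : castVec (x + y) = castVec x + castVec y := by
  ext i; simp [castVec]

theorem castVec_neg {d : ℕ} (x : Fin d → ℤ) : castVec (-x) = -castVec x := by
  ext i; simp [castVec]

theorem castVec_smul {d : ℕ} (n : ℤ) (x : Fin d → ℤ) :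
    castVec (n • x) = (n : ℝ) • castVec x := by
  ext i; simp [castVec]

theorem castVec_injective {d : ℕ} : Function.Injective (castVec (d := d)) := by
  intro x y h
  ext i
  have := congrFun h i
  simpa [castVec] using this

theorem cross_castVec (x y : Fin 2 → ℤ) : cross (castVec x) (castVec y) = ((cross x y : ℤ) : ℝ) := by
  simp [cross, castVec]

section CrossAlgebra

variable {R : Type*} [CommRing R] (x y z : Fin 2 → R) (c : R)

theorem cross_add_left : cross (x + y) z = cross x z + cross y z := by simp [cross]; ring

theorem cross_add_right : cross x (y + z) = cross x y + cross x z := by simp [cross]; ring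

theorem cross_sub_left : cross (x - y) z = cross x z - cross y z := by simp [cross]; ring

theorem cross_sub_right : cross x (y - z) = cross x y - cross x z := by simp [cross]; ring

theorem cross_neg_left : cross (-x) y = -cross x y := by simp [cross]; ring

theorem cross_neg_right : cross x (-y) = -cross x y := by simp [cross]; ring

theorem cross_smul_left : cross (c • x) y = c * cross x y := by simp [cross]; ring

theorem cross_smul_right : cross x (c • y) = c * cross x y := by simp [cross]; ring

theorem cross_vec_self : cross x x = 0 := by simp [cross]; ring

theorem cross_swap : cross x y = -cross y x := by simp [cross]; ring

/-- Cramer's rule in the plane. -/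
theorem cross_smul_eq : cross x y • z = cross z y • x + cross x z • y := by
  ext i; fin_cases i <;> simp [cross] <;> ring

end CrossAlgebra

theorem IsLatticePolytope.convex {d : ℕ} {P : Set (Fin d → ℝ)} (hP : IsLatticePolytope P) :
    Convex ℝ P := by
  obtain ⟨S, -, -, -, rfl⟩ := hP
  exact convex_convexHull ℝ S

theorem Convex.add_smul_mem_of_le {E : Type*} [AddCommGroup E] [Module ℝ E] {P : Set E}
    (hP : Convex ℝ P) {z u : E} {κ τ : ℝ} (hz : z ∈ P) (hκ : z + κ • u ∈ P) (h0 : 0 ≤ τ)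
    (h1 : τ ≤ κ) : z + τ • u ∈ P := by
  rcases eq_or_lt_of_le (h0.trans h1) with h | h
  · have : τ = 0 := by linarith
    simpa [this] using hz
  · have := hP.add_smul_mem hz hκ (t := τ / κ) ⟨by positivity, (div_le_one h).2 h1⟩
    rwa [smul_smul, div_mul_cancel₀ _ h.ne'] at this

theorem exists_dual (α β : ℝ) :
    ∃ l : StrongDual ℝ (Fin 2 → ℝ), ∀ z, l z = α * z 0 + β * z 1 :=
  ⟨α • ContinuousLinearMap.proj 0 + β • ContinuousLinearMap.proj 1, fun z => by simp⟩

theorem le_of_forall_mem_convexHull {d : ℕ} {S : Set (Fin d → ℝ)} {l : StrongDual ℝ (Fin d → ℝ)}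
    {m : ℝ} (h : ∀ s ∈ S, l s ≤ m) : ∀ x ∈ convexHull ℝ S, l x ≤ m := by
  have hc : Convex ℝ {x | l x ≤ m} := convex_halfSpace_le l.toLinearMap.isLinear m
  exact fun x hx => convexHull_min (fun s hs => h s hs) hc hx

/-! ### The mixed descent: lattice points in strips -/

/-- A plane lattice vector is a proper multiple of another one, or it is part of a lattice basis. -/
theorem exists_multiple_or_complement {u v : Fin 2 → ℤ} (hD : 2 ≤ cross u v) :
    (∃ (g : ℤ) (u₀ : Fin 2 → ℤ), 2 ≤ g ∧ u = g • u₀) ∨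
      ∃ (w : Fin 2 → ℤ) (j : ℤ), 0 ≤ j ∧ j < cross u v ∧ cross u v • w = v + j • u ∧
        cross u w = 1 := by
  by_cases hg : Int.gcd (u 0) (u 1) = 1
  · right
    have hb := Int.gcd_eq_gcd_ab (u 0) (u 1)
    rw [hg] at hb
    set a := Int.gcdA (u 0) (u 1)
    set b := Int.gcdB (u 0) (u 1)
    set w₀ : Fin 2 → ℤ := ![-b, a]
    have hw₀ : cross u w₀ = 1 := by simp [cross, w₀]; push_cast at hb; linarith
    have hc := cross_smul_eq u w₀ v
    rw [hw₀, one_smul] at hc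
    set D := cross u v
    set c := cross v w₀
    -- Cramer's rule reads `D • w₀ = v - c • u`; subtracting a multiple of `u` from `w₀` reduces
    -- `-c` modulo `D` and keeps `cross u w = 1`.
    refine ⟨w₀ - ((-c) / D) • u, (-c) % D, Int.emod_nonneg _ (by omega),
      Int.emod_lt_of_pos _ (by omega), ?_, ?_⟩
    · rw [Int.emod_def, hc]; module
    · rw [cross_sub_right, cross_smul_right, cross_vec_self, hw₀]; ring
  · left
    have h0 : Int.gcd (u 0) (u 1) ≠ 0 := by
      intro h
      rw [Int.gcd_eq_zero_iff] at h
      simp [cross, h.1, h.2] at hD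
    refine ⟨Int.gcd (u 0) (u 1), fun i => u i / Int.gcd (u 0) (u 1), by omega, ?_⟩
    ext i
    fin_cases i
    · simp [Int.mul_ediv_cancel' (Int.gcd_dvd_left (u 0) (u 1))]
    · simp [Int.mul_ediv_cancel' (Int.gcd_dvd_right (u 0) (u 1))]

/-- A lattice polytope without lattice points strictly inside the strip spanned by two parallel
lines through `p₁` and `p₂` has an edge crossing this strip. -/
theorem exists_edge_across {P : Set (Fin 2 → ℝ)} (hP : IsLatticePolytope P)
    {p₁ p₂ v w : Fin 2 → ℤ} {j : ℤ} (hp₁ : castVec p₁ ∈ P) (hp₂ : castVec p₂ ∈ P)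
    (hj : 0 < j) (hjD : j < cross (p₂ - p₁) v)
    (hw : cross (p₂ - p₁) v • w = v + j • (p₂ - p₁))
    (hfree : ∀ r, castVec r ∈ P → cross (r - p₁) v ≤ 0 ∨ cross (p₂ - p₁) v ≤ cross (r - p₁) v) :
    ∃ l : StrongDual ℝ (Fin 2 → ℝ), ∃ a ∈ P, ∃ b ∈ P, (∀ y ∈ P, l y ≤ l a) ∧ l a = l b ∧
      cross a (castVec v) ≠ cross b (castVec v) ∧ 0 < l (castVec v) ∧
      l a < l (castVec p₁ + castVec w) := by
  classical
  have hconv := hP.convex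
  obtain ⟨S, hSf, hSne, hSL, hPS⟩ := hP
  have hSP : S ⊆ P := hPS ▸ subset_convexHull ℝ S
  set D := cross (p₂ - p₁) v with hDdef
  set p := castVec p₁
  set u := castVec (p₂ - p₁) with hu
  have hpu : castVec p₂ = p + u := by rw [hu, castVec_sub]; simp [p]
  set V := castVec v
  have hDR : cross u V = (D : ℝ) := cross_castVec _ _
  have hD0 : (0 : ℝ) < D := by exact_mod_cast hj.trans hjD
  have hjR : (0 : ℝ) < j := by exact_mod_cast hj
  have hjDR : (j : ℝ) < D := by exact_mod_cast hjD
  have hwR : (D : ℝ) • castVec w = V + (j : ℝ) • u := by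
    rw [← castVec_smul, hw, castVec_add, castVec_smul]
  -- Oblique coordinates along `u` and `V`, scaled by `D`: the strip is `0 < X < D`, and `p₁`, `p₂`
  -- lie at `X = 0`, `X = D` on the axis `Y = 0`.
  let X : (Fin 2 → ℝ) → ℝ := fun z => cross (z - p) V
  let Y : (Fin 2 → ℝ) → ℝ := fun z => cross u (z - p)
  have hX : ∀ s ∈ S, X s ≤ 0 ∨ D ≤ X s := by
    intro s hs
    obtain ⟨r, rfl⟩ := hSL hs
    have : X (castVec r) = ((cross (r - p₁) v : ℤ) : ℝ) := by
      rw [← cross_castVec, castVec_sub]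
    change X (castVec r) ≤ 0 ∨ (D : ℝ) ≤ X (castVec r)
    rw [this]
    exact_mod_cast hfree r (hSP hs)
  have hdecomp : ∀ z, (D : ℝ) • (z - p) = X z • u + Y z • V := fun z => by
    rw [← hDR]; exact cross_smul_eq u V (z - p)
  obtain ⟨lX, hlX⟩ := exists_dual (V 1) (-V 0)
  have hlXX : ∀ z, lX z = X z + cross p V := fun z => by simp [hlX, X, cross]; ring
  let Sm := hSf.toFinset.filter (fun s => X s ≤ 0)
  let Sp := hSf.toFinset.filter (fun s => D ≤ X s)
  have hSm : ∀ {s}, s ∈ Sm ↔ s ∈ S ∧ X s ≤ 0 := by simp [Sm]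
  have hSp : ∀ {s}, s ∈ Sp ↔ s ∈ S ∧ D ≤ X s := by simp [Sp]
  have hSmne : Sm.Nonempty := by
    by_contra hne
    rw [Finset.not_nonempty_iff_eq_empty] at hne
    have h1 : ∀ s ∈ S, (-lX) s ≤ -(D + cross p V) := by
      intro s hs
      have h2 : ¬ X s ≤ 0 := fun h => by
        have := hSm.2 ⟨hs, h⟩
        simp [hne] at this
      have := (hX s hs).resolve_left h2
      simp [hlXX]; linarith
    have := le_of_forall_mem_convexHull h1 p (hPS ▸ hp₁)
    simp [hlXX, X, cross] at this
    linarith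
  have hSpne : Sp.Nonempty := by
    by_contra hne
    rw [Finset.not_nonempty_iff_eq_empty] at hne
    have h1 : ∀ s ∈ S, lX s ≤ cross p V := by
      intro s hs
      have h2 : ¬ D ≤ X s := fun h => by
        have := hSp.2 ⟨hs, h⟩
        simp [hne] at this
      have := (hX s hs).resolve_right h2
      simp [hlXX]; linarith
    have h3 := le_of_forall_mem_convexHull h1 (p + u) (hPS ▸ hpu ▸ hp₂)
    have h4 : X (p + u) = D := by rw [← hDR]; simp [X]
    rw [hlXX, h4] at h3
    linarith
  let sl : (Fin 2 → ℝ) → (Fin 2 → ℝ) → ℝ := fun a b => (Y b - Y a) / (X b - X a)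
  -- The min-max slope between the left and right vertices is the slope of the upper hull where it
  -- crosses the strip. The functional `l` below is `Y - k * X` up to a constant, so it is maximal
  -- along that edge.
  obtain ⟨a, ha, hamin⟩ := Finset.exists_min_image Sm (fun a => Sp.sup' hSpne (sl a)) hSmne
  obtain ⟨b, hb, hbk⟩ := Finset.exists_mem_eq_sup' hSpne (sl a)
  set k := sl a b with hk
  have ha' := hSm.1 ha
  have hb' := hSp.1 hb
  obtain ⟨l, hl⟩ := exists_dual (-u 1 - k * V 1) (u 0 + k * V 0)
  have hlXY : ∀ z, l z = Y z - k * X z + l p := fun z => by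
    simp [hl, X, Y, cross]; ring
  have hXab : 0 < X b - X a := by linarith [ha'.2, hb'.2]
  have hlab : l a = l b := by
    rw [hlXY a, hlXY b, hk]
    simp only [sl]
    field_simp
    ring
  have hlb : ∀ s ∈ Sp, l s ≤ l a := by
    intro s hs
    have h1 : sl a s ≤ k := by rw [← hbk]; exact Finset.le_sup' (sl a) hs
    have h2 : 0 < X s - X a := by linarith [ha'.2, (hSp.1 hs).2]
    simp only [sl] at h1
    rw [div_le_iff₀ h2] at h1
    rw [hlXY a, hlXY s]
    linarith
  have hla : ∀ s ∈ Sm, l s ≤ l a := by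
    intro s hs
    obtain ⟨t, ht, hst⟩ := Finset.exists_mem_eq_sup' hSpne (sl s)
    have h1 : k ≤ sl s t := by
      have := hamin s hs
      rw [hst, hbk] at this
      exact this
    have h2 : 0 < X t - X s := by linarith [(hSm.1 hs).2, (hSp.1 ht).2]
    simp only [sl] at h1
    rw [le_div_iff₀ h2] at h1
    refine le_trans ?_ (hlb t ht)
    rw [hlXY s, hlXY t]
    linarith
  have hmax : ∀ y ∈ P, l y ≤ l a := by
    rw [hPS]
    refine le_of_forall_mem_convexHull fun s hs => ?_
    rcases hX s hs with h | h
    · exact hla s (hSm.2 ⟨hs, h⟩)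
    · exact hlb s (hSp.2 ⟨hs, h⟩)
  refine ⟨l, a, hSP ha'.1, b, hSP hb'.1, hmax, hlab, ?_, ?_, ?_⟩
  · intro h
    have : X a = X b := by simp only [X, cross_sub_left, h]
    linarith
  · have : l V = D := by rw [← hDR, hl]; simp [cross]; ring
    rw [this]; exact hD0
  · set t := (j - X a) / (X b - X a) with ht
    have ht0 : 0 ≤ t := div_nonneg (by linarith [ha'.2]) hXab.le
    have ht1 : t ≤ 1 := by rw [ht, div_le_one hXab]; linarith [hb'.2]
    set z := a + t • (b - a) with hz
    have hzP : z ∈ P := hconv.add_smul_sub_mem (hSP ha'.1) (hSP hb'.1) ⟨ht0, ht1⟩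
    have hXz : X z = j := by
      have : X z = X a + t * (X b - X a) := by
        simp [X, hz, cross]; ring
      rw [this, ht]; field_simp; ring
    have hlz : l z = l a := by simp [hz, hlab]
    have hoP : p + ((j : ℝ) / D) • u ∈ P :=
      hconv.add_smul_mem hp₁ (hpu ▸ hp₂) ⟨by positivity, (div_le_one hD0).2 hjDR.le⟩
    have hwu : castVec w = ((j : ℝ) / D) • u + (1 / D : ℝ) • V := by
      have : castVec w = (1 / D : ℝ) • ((D : ℝ) • castVec w) := by
        rw [smul_smul, one_div_mul_cancel hD0.ne', one_smul]
      rw [this, hwR]; module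
    have hzo : z = p + ((j : ℝ) / D) • u + (Y z / D) • V := by
      have h1 : z - p = (1 / D : ℝ) • ((D : ℝ) • (z - p)) := by
        rw [smul_smul, one_div_mul_cancel hD0.ne', one_smul]
      rw [hdecomp, hXz] at h1
      rw [← sub_add_cancel z p, h1]
      have : Y (((1 : ℝ) / D) • ((j : ℝ) • u + Y z • V) + p) = Y z := by
        rw [← h1, sub_add_cancel]
      rw [this]; module
    -- The point `p₁ + w` has coordinates `X = j`, `Y = 1`. If the edge were at height at least `1`
    -- over `X = j`, the chord down to `[p₁, p₂]` would put this lattice point in `P`, inside the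
    -- strip.
    have hYz : Y z < 1 := by
      by_contra hY
      push Not at hY
      have hwP : p + castVec w ∈ P := by
        rw [hwu, ← add_assoc]
        exact hconv.add_smul_mem_of_le hoP (hzo ▸ hzP) (by positivity) (by gcongr)
      rw [← castVec_add] at hwP
      have h1 := hfree _ hwP
      have h2 : cross w v = j := by
        have := congrArg (fun x => cross x v) hw
        simp only [cross_smul_left, cross_add_left, cross_vec_self] at this
        rw [← hDdef, zero_add, mul_comm j] at this
        exact mul_left_cancel₀ (by omega) this
      rw [add_sub_cancel_left, h2] at h1
      omega
    have h1 : l (p + castVec w) = 1 - k * j + l p := by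
      rw [hlXY]
      have h2 : X (p + castVec w) = j := by
        simp only [X, add_sub_cancel_left, hwu, cross_add_left, cross_smul_left, cross_vec_self, hDR]
        field_simp; simp
      have h3 : Y (p + castVec w) = 1 := by
        simp only [Y, add_sub_cancel_left, hwu, cross_add_right, cross_smul_right, cross_vec_self, hDR]
        field_simp; simp
      rw [h2, h3]
    rw [h1, ← hlz, hlXY z, hXz]
    linarith

/-- If `P` is a weak Minkowski summand of `Q`, then every functional that is maximized over `P`
along an edge is maximized over `Q` along an edge. -/
theorem IsWeakMinkowskiSummand.exists_two_maximizers {d : ℕ} {P Q : Set (Fin d → ℝ)}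
    (hQ : IsLatticePolytope Q) (h : IsWeakMinkowskiSummand P Q)
    {l m : StrongDual ℝ (Fin d → ℝ)} {a b : Fin d → ℝ} (ha : a ∈ P) (hb : b ∈ P)
    (hmax : ∀ y ∈ P, l y ≤ l a) (hab : l a = l b) (hm : m a ≠ m b) :
    ∃ s s' : Fin d → ℤ, castVec s ∈ Q ∧ castVec s' ∈ Q ∧ s ≠ s' ∧
      (∀ y ∈ Q, l y ≤ l (castVec s)) ∧ l (castVec s') = l (castVec s) := by
  obtain ⟨S, hSf, hSne, hSL, hQS⟩ := hQ
  have hSQ : S ⊆ Q := hQS ▸ subset_convexHull ℝ S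
  obtain ⟨s₀, hs₀, hs₀max⟩ := Set.exists_max_image S l hSf hSne
  have hQmax : ∀ y ∈ Q, l y ≤ l s₀ := by
    rw [hQS]; exact le_of_forall_mem_convexHull hs₀max
  obtain ⟨z₀, hz₀⟩ := hSL hs₀
  change castVec z₀ = s₀ at hz₀
  subst hz₀
  by_contra hcon
  push Not at hcon
  have huniq : ∀ s ∈ S, s = castVec z₀ ∨ l s < l (castVec z₀) := by
    intro s hs
    obtain ⟨z, rfl⟩ := hSL hs
    change castVec z = _ ∨ l (castVec z) < _
    by_cases hzz : z₀ = z
    · left; rw [hzz]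
    · right
      exact lt_of_le_of_ne (hs₀max _ hs) (hcon z₀ z (hSQ hs₀) (hSQ hs) hzz hQmax)
  -- If the maximizer is unique in `S`, the finitely many strict inequalities survive a small
  -- perturbation of `l`, here towards both `m` and `-m`.
  have hpert : ∀ m' : StrongDual ℝ (Fin d → ℝ), ∀ᶠ ε in nhdsWithin (0 : ℝ) (Set.Ioi 0),
      ∀ s ∈ S, (l + ε • m') s ≤ (l + ε • m') (castVec z₀) := by
    intro m'
    rw [Filter.eventually_all_finite hSf]
    intro s hs
    rcases huniq s hs with rfl | hlt
    · simp
    · have hc : Continuous fun ε : ℝ => (l + ε • m') (castVec z₀) - (l + ε • m') s := by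
        simp; fun_prop
      have h0 : 0 < (fun ε : ℝ => (l + ε • m') (castVec z₀) - (l + ε • m') s) 0 := by
        simpa using hlt
      have := (hc.tendsto 0).eventually (lt_mem_nhds h0)
      filter_upwards [nhdsWithin_le_nhds this] with ε hε
      linarith
  obtain ⟨ε, ⟨h1, h2⟩, hε⟩ :=
    (((hpert m).and (hpert (-m))).and self_mem_nhdsWithin).exists
  have hε : 0 < ε := hε
  have hQ1 : ∀ y ∈ Q, (l + ε • m) y ≤ (l + ε • m) (castVec z₀) := by
    rw [hQS]; exact le_of_forall_mem_convexHull h1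
  have hQ2 : ∀ y ∈ Q, (l + ε • -m) y ≤ (l + ε • -m) (castVec z₀) := by
    rw [hQS]; exact le_of_forall_mem_convexHull h2
  let F : Set (Fin d → ℝ) := {x ∈ Q | ∀ y ∈ Q, l y ≤ l x}
  have hF : ∀ x ∈ F, l x = l (castVec z₀) ∧ m x = m (castVec z₀) := by
    intro x hx
    have h3 : l x = l (castVec z₀) := le_antisymm (hQmax x hx.1) (hx.2 _ (hSQ hs₀))
    have h4 := hQ1 x hx.1
    have h5 := hQ2 x hx.1
    simp [h3] at h4 h5
    exact ⟨h3, le_antisymm (le_of_mul_le_mul_left h4 hε)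
      (le_of_mul_le_mul_left (by linarith) hε)⟩
  -- Refinement places `l` and `l ± ε • m` in one normal cone of `P`. A point `p` of its face
  -- maximizes all three functionals, which forces `m a = m p = m b`.
  obtain ⟨B, ⟨G, ⟨p, hpG⟩, hGexp, rfl⟩, hsub⟩ := h.2 (normalCone Q F)
    ⟨F, ⟨castVec z₀, hSQ hs₀, hQmax⟩, fun _ => ⟨l, rfl⟩, rfl⟩
  have hp : ∀ l' : StrongDual ℝ (Fin d → ℝ), (∀ y ∈ Q, l' y ≤ l' (castVec z₀)) → (∀ x ∈ F, l' x = l' (castVec z₀)) →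
      ∀ y ∈ P, l' y ≤ l' p := by
    intro l' hl' hl'F y hy
    have : l' ∈ normalCone Q F := fun x hx y hy => by rw [hl'F x hx]; exact hl' y hy
    exact hsub this p hpG y hy
  have hp1 := hp _ hQ1 fun x hx => by simp [hF x hx]
  have hp2 := hp _ hQ2 fun x hx => by simp [hF x hx]
  have hpP : p ∈ P := hGexp.subset hpG
  have e0 : l p = l a := le_antisymm (hmax p hpP) (hp l hQmax (fun x hx => (hF x hx).1) a ha)
  have a1 := hp1 a ha
  have a2 := hp2 a ha
  have b1 := hp1 b hb
  have b2 := hp2 b hb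
  simp [e0, ← hab] at a1 a2 b1 b2
  apply hm
  have e1 := le_of_mul_le_mul_left (show ε * m a ≤ ε * m p by linarith) hε
  have e2 := le_of_mul_le_mul_left (show ε * m p ≤ ε * m a by linarith) hε
  have e3 := le_of_mul_le_mul_left (show ε * m b ≤ ε * m p by linarith) hε
  have e4 := le_of_mul_le_mul_left (show ε * m p ≤ ε * m b by linarith) hε
  linarith

/-- Under the freeness assumptions, the edge of `Q` parallel to the edge of `P` that crosses the
strip produces a chord of `Q` that is a translate of `[0, p₂ - p₁]` on the far side of `q₂`. -/
theorem exists_chord_of_free {P Q : Set (Fin 2 → ℝ)} (hP : IsLatticePolytope P)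
    (hQ : IsLatticePolytope Q) (h : IsWeakMinkowskiSummand P Q) {p₁ p₂ q₁ q₂ w : Fin 2 → ℤ} {j : ℤ}
    (hp₁ : castVec p₁ ∈ P) (hp₂ : castVec p₂ ∈ P) (hq₁ : castVec q₁ ∈ Q) (hq₂ : castVec q₂ ∈ Q)
    (hj : 0 < j) (hjD : j < cross (p₂ - p₁) (q₂ - q₁))
    (hw : cross (p₂ - p₁) (q₂ - q₁) • w = (q₂ - q₁) + j • (p₂ - p₁))
    (huw : cross (p₂ - p₁) w = 1)
    (hPfree : ∀ r, castVec r ∈ P → cross (r - p₁) (q₂ - q₁) ≤ 0 ∨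
      cross (p₂ - p₁) (q₂ - q₁) ≤ cross (r - p₁) (q₂ - q₁))
    (hQfree : ∀ r, castVec r ∈ Q → cross (p₂ - p₁) (r - q₁) ≤ 0 ∨
      cross (p₂ - p₁) (q₂ - q₁) ≤ cross (p₂ - p₁) (r - q₁)) :
    ∃ z ∈ Q, z + castVec (p₂ - p₁) ∈ Q ∧
      ((cross (p₂ - p₁) (q₂ - q₁) : ℤ) : ℝ) ≤ cross (castVec (p₂ - p₁)) (z - castVec q₁) := by
  have hconv := hQ.convex
  obtain ⟨l, a, ha, b, hb, hmax, hlab, hne, hlV, hlw⟩ :=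
    exists_edge_across hP hp₁ hp₂ hj hjD hw hPfree
  have hl1 := hmax _ hp₁
  have hl2 := hmax _ hp₂
  have hp₂' : castVec p₂ = castVec p₁ + castVec (p₂ - p₁) := by rw [castVec_sub]; simp
  have hq₂' : castVec q₂ = castVec q₁ + castVec (q₂ - q₁) := by rw [castVec_sub]; simp
  set u := p₂ - p₁
  set v := q₂ - q₁
  set D := cross u v with hD
  set U := castVec u with hU
  set V := castVec v with hV
  set W := castVec w with hW
  set o := castVec q₁ with ho
  rw [hp₂', map_add] at hl2
  rw [map_add] at hlw
  have hlW : 0 < l W := by linarith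
  have hlUW : l U < l W := by linarith
  have hjD1 : (j : ℝ) ≤ D - 1 := by
    have : j ≤ D - 1 := by omega
    exact_mod_cast this
  have hj1 : (1 : ℝ) ≤ j := by exact_mod_cast hj
  have hD0 : (0 : ℝ) < D := by linarith
  have hUW : cross U W = 1 := by rw [hU, hW, cross_castVec, huw]; simp
  have hUV : cross U V = D := by rw [hU, hV, cross_castVec]
  have hwR : (D : ℝ) • W = V + (j : ℝ) • U := by
    rw [hW, ← castVec_smul, hw, castVec_add, castVec_smul]
  have hVR : V = (D : ℝ) • W - (j : ℝ) • U := by rw [hwR]; simp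
  have hwv : cross w v = j := by
    have h2 := congrArg (fun x => cross x v) hw
    simp only [cross_smul_left, cross_add_left, cross_vec_self] at h2
    rw [zero_add, mul_comm j] at h2
    exact mul_left_cancel₀ (by omega) h2
  -- On the line at level `1`, `[q₁, q₂]` passes through `θ = -j / D`, while freeness excludes the
  -- lattice points `q₁ + w - u` and `q₁ + w` at `θ = -1` and `θ = 0`.
  have hlev1 : ∀ θ : ℝ, o + W + θ • U ∈ Q → -1 < θ ∧ θ < 0 := by
    have hbase : o + W + (-(j / D : ℝ)) • U ∈ Q := by
      have : o + W + (-(j / D : ℝ)) • U = o + (1 / D : ℝ) • V := by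
        rw [hVR, smul_sub, smul_smul, smul_smul, one_div_mul_cancel hD0.ne']
        module
      rw [this]
      refine hconv.add_smul_mem hq₁ (hq₂' ▸ hq₂) ⟨by positivity, ?_⟩
      rw [div_le_one hD0]; linarith
    have hjd : (j / D : ℝ) < 1 := by rw [div_lt_one hD0]; linarith
    have hjd0 : (0 : ℝ) < j / D := by positivity
    intro θ hθ
    constructor
    · by_contra hcon
      push Not at hcon
      have h1 : o + W + θ • U + (-(j / D : ℝ) - θ) • U ∈ Q := by
        have : o + W + θ • U + (-(j / D : ℝ) - θ) • U = o + W + (-(j / D : ℝ)) • U := by module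
        rwa [this]
      have h2 := hconv.add_smul_mem_of_le hθ h1 (τ := -1 - θ) (by linarith) (by linarith)
      have h3 : o + W + θ • U + (-1 - θ) • U = castVec (q₁ + w - u) := by
        rw [castVec_sub, castVec_add]; module
      rw [h3] at h2
      have h4 := hQfree _ h2
      rw [show q₁ + w - u - q₁ = w - u by abel, cross_sub_right, cross_vec_self, huw] at h4
      omega
    · by_contra hcon
      push Not at hcon
      have h1 : o + W + (-(j / D : ℝ)) • U + (θ + (j / D : ℝ)) • U ∈ Q := by
        have : o + W + (-(j / D : ℝ)) • U + (θ + (j / D : ℝ)) • U = o + W + θ • U := by module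
        rwa [this]
      have h2 := hconv.add_smul_mem_of_le hbase h1 (τ := (j / D : ℝ)) (by linarith) (by linarith)
      have h3 : o + W + (-(j / D : ℝ)) • U + (j / D : ℝ) • U = castVec (q₁ + w) := by
        rw [castVec_add]; module
      rw [h3] at h2
      have h4 := hQfree _ h2
      rw [show q₁ + w - q₁ = w by abel, huw] at h4
      omega
  have hdec : ∀ z : Fin 2 → ℝ, z = o + cross U (z - o) • W + cross (z - o) W • U := fun z => by
    have := cross_smul_eq U W (z - o)
    rw [hUW, one_smul] at this
    rw [add_assoc, add_comm (cross U (z - o) • W), ← this]; simp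
  have hint1 : ∀ s : Fin 2 → ℤ, cross U (castVec s - o) = ((cross u (s - q₁) : ℤ) : ℝ) := fun s => by
    rw [← cross_castVec, castVec_sub s q₁]
  have hint2 : ∀ s : Fin 2 → ℤ, cross (castVec s - o) W = ((cross (s - q₁) w : ℤ) : ℝ) := fun s => by
    rw [← cross_castVec, castVec_sub]
  -- A maximizer at level at most `0` would be joined to `q₂` by a segment meeting level `1` at some
  -- `z` with `l z ≥ l q₂`. The bounds on `θ`, `l U < l W` and `j ≤ D - 1` contradict this.
  have hlevel : ∀ s : Fin 2 → ℤ, castVec s ∈ Q → (∀ y ∈ Q, l y ≤ l (castVec s)) →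
      D ≤ cross u (s - q₁) := by
    intro s hs hsmax
    by_contra hcon
    have hB := (hQfree s hs).resolve_right hcon
    set B := cross u (s - q₁) with hBdef
    have hBR : (B : ℝ) ≤ 0 := by exact_mod_cast hB
    set τ : ℝ := (1 - B) / (D - B) with hτ
    have hDB : (0 : ℝ) < D - B := by linarith
    have hτ0 : 0 ≤ τ := div_nonneg (by linarith) hDB.le
    have hτ1 : τ ≤ 1 := by rw [hτ, div_le_one hDB]; linarith
    set z := castVec s + τ • (castVec q₂ - castVec s) with hz
    have hzQ : z ∈ Q := hconv.add_smul_sub_mem hs hq₂ ⟨hτ0, hτ1⟩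
    have hzlev : cross U (z - o) = 1 := by
      have h1 : z - o = (1 - τ) • (castVec s - o) + τ • V := by
        rw [hz, hq₂']; module
      rw [h1, cross_add_right, cross_smul_right, cross_smul_right, hint1, hUV, ← hBdef, hτ]
      field_simp; ring
    have hzd := hdec z
    rw [hzlev, one_smul] at hzd
    set θ := cross (z - o) W
    obtain ⟨hθ1, hθ2⟩ := hlev1 θ (hzd ▸ hzQ)
    have hlz : l z ≥ l (castVec q₂) := by
      have h1 := hsmax _ hq₂
      rw [hz, map_add, map_smul, map_sub, smul_eq_mul]
      nlinarith
    have hlz' : l z = l o + l W + θ * l U := by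
      rw [hzd]; simp
    rw [ge_iff_le, hlz', hq₂', map_add, hVR, map_sub, map_smul, map_smul, smul_eq_mul,
      smul_eq_mul] at hlz
    have h1 : (j + θ) * l U < (j + θ) * l W := mul_lt_mul_of_pos_left hlUW (by linarith)
    have h2 : (j + θ) * l W < (D - 1) * l W := mul_lt_mul_of_pos_right (by linarith) hlW
    linarith
  obtain ⟨mX, hmX⟩ := exists_dual (V 1) (-V 0)
  have hmX' : ∀ z, mX z = cross z V := fun z => by rw [hmX]; simp [cross]; ring
  obtain ⟨s, s', hs, hs', hss, hsmax, hsl, hpos⟩ : ∃ s s' : Fin 2 → ℤ, castVec s ∈ Q ∧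
      castVec s' ∈ Q ∧ s ≠ s' ∧ (∀ y ∈ Q, l y ≤ l (castVec s)) ∧
      l (castVec s') = l (castVec s) ∧ 0 < cross (s' - s) v := by
    obtain ⟨s, s', hs, hs', hss, hsmax, hsl⟩ :=
      h.exists_two_maximizers hQ (m := mX) ha hb hmax hlab (by rwa [hmX', hmX'])
    rcases lt_trichotomy 0 (cross (s' - s) v) with h1 | h1 | h1
    · exact ⟨s, s', hs, hs', hss, hsmax, hsl, h1⟩
    -- Otherwise `s' - s` would be parallel to `v`, on which `l` is positive.
    · exfalso
      have h2 := cross_smul_eq u v (s' - s)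
      rw [← h1, zero_smul, zero_add] at h2
      have h3 := congrArg (fun x => l (castVec x)) h2
      simp only [castVec_smul, map_smul, castVec_sub, map_sub, hsl, sub_self, smul_zero] at h3
      rw [eq_comm, smul_eq_mul, mul_eq_zero] at h3
      have h4 : cross u (s' - s) = 0 := by
        rcases h3 with h3 | h3
        · exact_mod_cast h3
        · exact absurd h3 hlV.ne'
      rw [h4, zero_smul, smul_eq_zero] at h2
      rcases h2 with h2 | h2
      · omega
      · exact hss (sub_eq_zero.1 h2).symm
    · refine ⟨s', s, hs', hs, hss.symm, fun y hy => hsl ▸ hsmax y hy, hsl.symm, ?_⟩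
      rw [← neg_sub, cross_neg_left]; omega
  have hys := hlevel s hs hsmax
  have hys' := hlevel s' hs' (fun y hy => hsl ▸ hsmax y hy)
  have hsd := hdec (castVec s)
  have hsd' := hdec (castVec s')
  rw [hint1, hint2] at hsd hsd'
  have hf := cross_smul_eq u w (s' - s)
  rw [huw, one_smul] at hf
  have hfa : cross (s' - s) w = cross (s' - q₁) w - cross (s - q₁) w := by
    rw [← cross_sub_left]; congr 1; abel
  have hfb : cross u (s' - s) = cross u (s' - q₁) - cross u (s - q₁) := by
    rw [← cross_sub_right]; congr 1; abel
  have hlf : ((cross (s' - s) w : ℤ) : ℝ) * l U + ((cross u (s' - s) : ℤ) : ℝ) * l W = 0 := by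
    have := congrArg (fun x => l (castVec x)) hf
    simp only [castVec_add, castVec_smul, castVec_sub, map_add, map_sub, map_smul, hsl, sub_self,
      smul_eq_mul] at this
    exact this.symm
  have hpos' : 0 < cross (s' - s) w * D + cross u (s' - s) * j := by
    have : cross (s' - s) v = cross (s' - s) w * D + cross u (s' - s) * j := by
      conv_lhs => rw [hf]
      rw [cross_add_left, cross_smul_left, cross_smul_left, hwv]
    rwa [← this]
  set a' := cross (s' - s) w
  set b' := cross u (s' - s)
  set x := cross (s - q₁) w
  set y := cross u (s - q₁)
  set x' := cross (s' - q₁) w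
  set y' := cross u (s' - q₁)
  have hy0 : (0 : ℝ) < y := by exact_mod_cast (by omega : 0 < y)
  have hy0' : (0 : ℝ) < y' := by exact_mod_cast (by omega : 0 < y')
  -- Shrinking towards `q₁` down to level `1` carries the bounds on `θ` to every point of `Q` at
  -- level `c ≥ 1`.
  have hlvl : ∀ {z : Fin 2 → ℝ} {c θ : ℝ}, 1 ≤ c → z = o + c • W + θ • U → z ∈ Q →
      -1 < θ / c ∧ θ / c < 0 := by
    intro z c θ hc hz hzQ
    apply hlev1
    have h1 := hconv.add_smul_sub_mem hq₁ hzQ (t := 1 / c)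
      ⟨by positivity, by rw [div_le_one (by linarith)]; exact hc⟩
    have h2 : o + (1 / c) • (z - o) = o + W + (θ / c) • U := by
      rw [hz]
      have : (1 / c) • (o + c • W + θ • U - o) = ((1 / c) * c) • W + (θ / c) • U := by module
      rw [this, one_div_mul_cancel (by linarith), one_smul]; abel
    rwa [h2] at h1
  -- The chord is taken at the level of the lower endpoint. The segment from `q₁` to the other
  -- endpoint meets that level at distance at least one `U`, on the right when `s` is lower and on
  -- the left when `s'` is.
  rcases le_or_gt 0 b' with hb0 | hb0
  · have ha1 : 1 ≤ a' := by
      by_contra hcon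
      have ha0 : a' ≤ 0 := by omega
      have h1 : -a' < b' := by
        by_contra h2
        nlinarith
      have h1R : -(a' : ℝ) < b' := by exact_mod_cast h1
      have ha0R : (a' : ℝ) ≤ 0 := by exact_mod_cast ha0
      have h2 : (-(a' : ℝ)) * l U ≤ (-(a' : ℝ)) * l W :=
        mul_le_mul_of_nonneg_left hlUW.le (by linarith)
      have h3 : (-(a' : ℝ)) * l W < b' * l W := mul_lt_mul_of_pos_right h1R hlW
      linarith
    have hx' : (x' : ℝ) = x + a' := by
      have : x' = x + a' := by omega
      exact_mod_cast this
    have hyy' : (y : ℝ) ≤ y' := by exact_mod_cast (by omega : y ≤ y')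
    have ha1R : (1 : ℝ) ≤ a' := by exact_mod_cast ha1
    have hneg := (hlvl (by exact_mod_cast (by omega : 1 ≤ y')) hsd' hs').2
    have hx0 : (x' : ℝ) < 0 := by
      rcases div_neg_iff.1 hneg with h1 | h1
      · linarith [h1.2]
      · exact h1.1
    have hm : o + ((y / y' : ℝ)) • (castVec s' - o) ∈ Q := hconv.add_smul_sub_mem hq₁ hs'
      ⟨by positivity, by rwa [div_le_one hy0']⟩
    have hm' : o + ((y / y' : ℝ)) • (castVec s' - o) =
        castVec s + (x' * (y / y') - x : ℝ) • U := by
      rw [hsd, hsd']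
      have : o + ((y / y' : ℝ)) • (o + (y' : ℝ) • W + (x' : ℝ) • U - o) =
        o + ((y / y' : ℝ) * y') • W + (x' * (y / y') : ℝ) • U := by module
      rw [this, div_mul_cancel₀ _ hy0'.ne']; module
    rw [hm'] at hm
    have h1 : (x' : ℝ) * 1 ≤ x' * (y / y') :=
      mul_le_mul_of_nonpos_left (by rwa [div_le_one hy0']) hx0.le
    refine ⟨castVec s, hs, ?_, ?_⟩
    · have := hconv.add_smul_mem_of_le hs hm (τ := 1) zero_le_one (by linarith)
      rwa [one_smul] at this
    · rw [hint1]; exact_mod_cast hys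
  · have ha1 : 1 ≤ a' + b' := by
      by_contra hcon
      have ha0 : a' ≤ -b' := by omega
      have ha2 : 0 < a' := by
        by_contra h2
        nlinarith
      have ha0R : (a' : ℝ) ≤ -b' := by exact_mod_cast ha0
      have ha2R : (0 : ℝ) < a' := by exact_mod_cast ha2
      have h2 : (a' : ℝ) * l U < a' * l W := mul_lt_mul_of_pos_left hlUW ha2R
      have h3 : (a' : ℝ) * l W ≤ -b' * l W := mul_le_mul_of_nonneg_right ha0R hlW.le
      linarith
    have hx' : (x' : ℝ) = x + a' := by
      have : x' = x + a' := by omega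
      exact_mod_cast this
    have hyb : (y' : ℝ) = y + b' := by
      have : y' = y + b' := by omega
      exact_mod_cast this
    have hyy' : (y' : ℝ) ≤ y := by exact_mod_cast (by omega : y' ≤ y)
    have ha1R : (1 : ℝ) ≤ a' + b' := by exact_mod_cast ha1
    have hneg := (hlvl (by exact_mod_cast (by omega : 1 ≤ y)) hsd hs).1
    rw [lt_div_iff₀ hy0] at hneg
    have hm : o + ((y' / y : ℝ)) • (castVec s - o) ∈ Q := hconv.add_smul_sub_mem hq₁ hs
      ⟨by positivity, by rwa [div_le_one hy0]⟩
    have hm' : o + ((y' / y : ℝ)) • (castVec s - o) =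
        castVec s' + (x' - x * (y' / y) : ℝ) • (-U) := by
      rw [hsd, hsd']
      have : o + ((y' / y : ℝ)) • (o + (y : ℝ) • W + (x : ℝ) • U - o) =
        o + ((y' / y : ℝ) * y) • W + (x * (y' / y) : ℝ) • U := by module
      rw [this, div_mul_cancel₀ _ hy0.ne']; module
    rw [hm'] at hm
    have h1 : ((x : ℝ) + y) * (y' / y) ≤ (x + y) * 1 :=
      mul_le_mul_of_nonneg_left (by rwa [div_le_one hy0]) (by linarith)
    have h2 : (y : ℝ) * (y' / y) = y' := mul_div_cancel₀ _ hy0.ne'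
    refine ⟨castVec s' - U, ?_, by simpa using hs', ?_⟩
    · have := hconv.add_smul_mem_of_le hs' hm (τ := 1) zero_le_one (by linarith)
      rwa [one_smul, ← sub_eq_add_neg] at this
    · rw [show castVec s' - U - o = castVec s' - o - U by abel, cross_sub_right, cross_vec_self,
        hint1, sub_zero]
      exact_mod_cast hys'

/-- If both strips were free, the cases of a non-primitive `u` and of `j = 0` would give a lattice
point on `[p₁, p₂]` or `[q₁, q₂]`. Otherwise there are chords of length `U` on both sides of the
strip in `Q`, and interpolating between them gives one at level `1`. -/
theorem exists_strip_point_of_pos {P Q : Set (Fin 2 → ℝ)} (hP : IsLatticePolytope P)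
    (hQ : IsLatticePolytope Q) (h : IsWeakMinkowskiSummand P Q) {p₁ p₂ q₁ q₂ : Fin 2 → ℤ}
    (hp₁ : castVec p₁ ∈ P) (hp₂ : castVec p₂ ∈ P) (hq₁ : castVec q₁ ∈ Q) (hq₂ : castVec q₂ ∈ Q)
    (hD : 2 ≤ cross (p₂ - p₁) (q₂ - q₁)) :
    (∃ r, castVec r ∈ P ∧ 0 < cross (r - p₁) (q₂ - q₁) ∧
      cross (r - p₁) (q₂ - q₁) < cross (p₂ - p₁) (q₂ - q₁)) ∨
    (∃ r, castVec r ∈ Q ∧ 0 < cross (p₂ - p₁) (r - q₁) ∧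
      cross (p₂ - p₁) (r - q₁) < cross (p₂ - p₁) (q₂ - q₁)) := by
  by_contra! hcon
  obtain ⟨hPc, hQc⟩ := hcon
  have hPfree : ∀ r, castVec r ∈ P → cross (r - p₁) (q₂ - q₁) ≤ 0 ∨
      cross (p₂ - p₁) (q₂ - q₁) ≤ cross (r - p₁) (q₂ - q₁) := fun r hr => by
    by_contra! h1; have := hPc r hr h1.1; omega
  have hQfree : ∀ r, castVec r ∈ Q → cross (p₂ - p₁) (r - q₁) ≤ 0 ∨
      cross (p₂ - p₁) (q₂ - q₁) ≤ cross (p₂ - p₁) (r - q₁) := fun r hr => by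
    by_contra! h1; have := hQc r hr h1.1; omega
  clear hPc hQc
  rcases exists_multiple_or_complement hD with ⟨g, u₀, hg, hu⟩ | ⟨w, j, hj0, hjD, hw, huw⟩
  · have hm : castVec (p₁ + u₀) ∈ P := by
      have hgR : (2 : ℝ) ≤ g := by exact_mod_cast hg
      have h1 : castVec (p₁ + u₀) = castVec p₁ + (1 / g : ℝ) • (castVec p₂ - castVec p₁) := by
        rw [← castVec_sub, hu, castVec_smul, smul_smul, one_div_mul_cancel (by linarith), one_smul,
          castVec_add]
      rw [h1]
      exact hP.convex.add_smul_sub_mem hp₁ hp₂ ⟨by positivity, by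
        rw [div_le_one (by linarith)]; linarith⟩
    have h1 := hPfree _ hm
    rw [add_sub_cancel_left, hu, cross_smul_left] at h1
    rw [hu, cross_smul_left] at hD
    rcases h1 with h1 | h1 <;> nlinarith
  rcases hj0.eq_or_lt with hj0 | hj0
  · have hDR : (2 : ℝ) ≤ (cross (p₂ - p₁) (q₂ - q₁) : ℤ) := by exact_mod_cast hD
    have hm : castVec (q₁ + w) ∈ Q := by
      have h1 : castVec (q₁ + w) = castVec q₁ +
          (1 / (cross (p₂ - p₁) (q₂ - q₁) : ℤ) : ℝ) • (castVec q₂ - castVec q₁) := by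
        rw [← hj0, zero_smul, add_zero] at hw
        have h2 : castVec (q₂ - q₁) = ((cross (p₂ - p₁) (q₂ - q₁) : ℤ) : ℝ) • castVec w := by
          rw [← castVec_smul, hw]
        rw [← castVec_sub, h2, smul_smul, one_div_mul_cancel (by linarith), one_smul, castVec_add]
      rw [h1]
      exact hQ.convex.add_smul_sub_mem hq₁ hq₂ ⟨by positivity, by
        rw [div_le_one (by linarith)]; linarith⟩
    have h1 := hQfree _ hm
    rw [add_sub_cancel_left, huw] at h1
    omega
  obtain ⟨z, hz, hzu, hzl⟩ := exists_chord_of_free hP hQ h hp₁ hp₂ hq₁ hq₂ hj0 hjD hw huw hPfree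
    hQfree
  have hu' : p₁ - p₂ = -(p₂ - p₁) := by abel
  have hv' : q₁ - q₂ = -(q₂ - q₁) := by abel
  have hr : ∀ r, r - p₂ = (r - p₁) - (p₂ - p₁) := fun r => by abel
  have hr' : ∀ r, r - q₂ = (r - q₁) - (q₂ - q₁) := fun r => by abel
  have hDD : cross (p₁ - p₂) (q₁ - q₂) = cross (p₂ - p₁) (q₂ - q₁) := by
    rw [hu', hv', cross_neg_left, cross_neg_right, neg_neg]
  -- Exchanging the endpoints of both segments negates `u` and `v`, hence `w`, and keeps `j` and the
  -- determinant; the resulting chord is at level at most `0`.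
  obtain ⟨y, hy, hyu, hyl⟩ := exists_chord_of_free hP hQ h hp₂ hp₁ hq₂ hq₁ (w := -w) (j := j) hj0
    (by rwa [hDD]) (by rw [hDD, smul_neg, hw, hu', hv']; module)
    (by rw [hu', cross_neg_left, cross_neg_right, neg_neg, huw])
    (fun r hrP => by
      rw [hDD, hv', hr, cross_neg_right, cross_sub_left]
      have := hPfree r hrP
      omega)
    (fun r hrQ => by
      rw [hDD, hu', hr', cross_neg_left, cross_sub_right]
      have := hQfree r hrQ
      omega)
  rw [hDD] at hyl
  have hq₂' : castVec q₂ = castVec q₁ + castVec (q₂ - q₁) := by rw [castVec_sub]; simp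
  have hUV : cross (castVec (p₂ - p₁)) (castVec (q₂ - q₁)) =
    ((cross (p₂ - p₁) (q₂ - q₁) : ℤ) : ℝ) := cross_castVec _ _
  have hUW : cross (castVec (p₂ - p₁)) (castVec w) = 1 := by rw [cross_castVec, huw]; simp
  rw [hu', castVec_neg] at hyu hyl
  rw [hq₂', ← sub_sub, cross_neg_left, cross_sub_right _ (y - castVec q₁), hUV] at hyl
  set U := castVec (p₂ - p₁) with hU
  set o := castVec q₁ with ho
  set D := cross (p₂ - p₁) (q₂ - q₁)
  have hDR : (2 : ℝ) ≤ D := by exact_mod_cast hD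
  set α := cross U (z - o)
  set β := cross U (y - o) with hβ
  set t : ℝ := (1 - β) / (α - β) with ht
  have hαβ : 0 < α - β := by linarith
  have ht0 : 0 ≤ t := div_nonneg (by linarith) hαβ.le
  have ht1 : t ≤ 1 := by rw [ht, div_le_one hαβ]; linarith
  set x := (y + -U) + t • (z - (y + -U)) with hx
  have hxQ : x ∈ Q := hQ.convex.add_smul_sub_mem hyu hz ⟨ht0, ht1⟩
  have hxuQ : x + (1 : ℝ) • U ∈ Q := by
    have := hQ.convex.add_smul_sub_mem hy hzu ⟨ht0, ht1⟩
    have h1 : y + t • (z + U - y) = x + (1 : ℝ) • U := by rw [hx]; module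
    rwa [h1] at this
  have hxl : cross U (x - o) = 1 := by
    have h1 : x - o = (1 - t) • (y - o) + t • (z - o) + (-(1 - t)) • U := by rw [hx]; module
    rw [h1, cross_add_right, cross_add_right, cross_smul_right, cross_smul_right, cross_smul_right,
      cross_vec_self, mul_zero, add_zero, ← hβ, ht]
    field_simp; ring
  have hxd := cross_smul_eq U (castVec w) (x - o)
  rw [hUW, hxl, one_smul, one_smul] at hxd
  set θ := cross (x - o) (castVec w)
  -- Lattice points at level `1` are one `u` apart, so a closed chord of that length contains one;
  -- rounding `θ` up finds it.
  have hfin := hQ.convex.add_smul_mem_of_le hxQ hxuQ (τ := ⌈θ⌉ - θ)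
    (by linarith [Int.le_ceil θ]) (by linarith [Int.ceil_lt_add_one θ])
  have h1 : x + ((⌈θ⌉ : ℝ) - θ) • U = castVec (q₁ + w + ⌈θ⌉ • (p₂ - p₁)) := by
    rw [castVec_add, castVec_add, castVec_smul, ← sub_add_cancel x o, hxd]; module
  rw [h1] at hfin
  have h2 := hQfree _ hfin
  rw [add_assoc, add_sub_cancel_left, cross_add_right, cross_smul_right, cross_vec_self, huw] at h2
  omega

/-- The descent step: a mixed lattice tetrahedron of normalized volume at least two can be refined
by a lattice point of `P` or of `Q`. -/
theorem exists_strip_point {P Q : Set (Fin 2 → ℝ)} (hP : IsLatticePolytope P)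
    (hQ : IsLatticePolytope Q) (h : IsWeakMinkowskiSummand P Q) {p₁ p₂ q₁ q₂ : Fin 2 → ℤ}
    (hp₁ : castVec p₁ ∈ P) (hp₂ : castVec p₂ ∈ P) (hq₁ : castVec q₁ ∈ Q) (hq₂ : castVec q₂ ∈ Q)
    (hD : 2 ≤ |cross (p₂ - p₁) (q₂ - q₁)|) :
    (∃ r, castVec r ∈ P ∧ ∃ θ : ℝ, 0 < θ ∧ θ < 1 ∧
      ((cross (r - p₁) (q₂ - q₁) : ℤ) : ℝ) = θ * (cross (p₂ - p₁) (q₂ - q₁) : ℤ)) ∨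
    (∃ r, castVec r ∈ Q ∧ ∃ θ : ℝ, 0 < θ ∧ θ < 1 ∧
      ((cross (p₂ - p₁) (r - q₁) : ℤ) : ℝ) = θ * (cross (p₂ - p₁) (q₂ - q₁) : ℤ)) := by
  have key : ∀ m n : ℤ, 0 < m → m < n → ∃ θ : ℝ, 0 < θ ∧ θ < 1 ∧ (m : ℝ) = θ * n := by
    intro m n hm hmn
    have hm' : (0 : ℝ) < m := by exact_mod_cast hm
    have hmn' : (m : ℝ) < n := by exact_mod_cast hmn
    have hn : (0 : ℝ) < n := hm'.trans hmn'
    exact ⟨m / n, by positivity, by rwa [div_lt_one hn], by field_simp⟩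
  rcases le_abs.1 hD with hD | hD
  · rcases exists_strip_point_of_pos hP hQ h hp₁ hp₂ hq₁ hq₂ hD with ⟨r, hr, h1, h2⟩ | ⟨r, hr, h1, h2⟩
    · exact Or.inl ⟨r, hr, key _ _ h1 h2⟩
    · exact Or.inr ⟨r, hr, key _ _ h1 h2⟩
  · have hv : q₁ - q₂ = -(q₂ - q₁) := by abel
    have hD' : 2 ≤ cross (p₂ - p₁) (q₁ - q₂) := by rw [hv, cross_neg_right]; exact hD
    rcases exists_strip_point_of_pos hP hQ h hp₁ hp₂ hq₂ hq₁ hD' with ⟨r, hr, h1, h2⟩ | ⟨r, hr, h1, h2⟩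
    · obtain ⟨θ, h3, h4, h5⟩ := key _ _ h1 h2
      refine Or.inl ⟨r, hr, θ, h3, h4, ?_⟩
      rw [hv, cross_neg_right, cross_neg_right] at h5
      push_cast at h5
      linarith
    · obtain ⟨θ, h3, h4, h5⟩ := key _ _ h1 h2
      -- The ratio was measured from `q₂`; measured from `q₁` it is complementary.
      refine Or.inr ⟨r, hr, 1 - θ, by linarith, by linarith, ?_⟩
      have h6 : r - q₁ = (r - q₂) + (q₂ - q₁) := by abel
      rw [h6, cross_add_right]
      rw [hv, cross_neg_right] at h5
      push_cast at h5 ⊢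
      linarith

/-! ### Unimodular triangles and exits from a triangle -/

/-- The ratio test: moving from a nonnegative weight vector in a direction with a negative entry,
one reaches the boundary of the orthant. -/
theorem exists_ratio {ι : Type*} [Fintype ι] {c d : ι → ℝ} (hc : ∀ i, 0 ≤ c i)
    (hd : ∃ i, d i < 0) :
    ∃ τ : ℝ, 0 ≤ τ ∧ (∀ i, 0 ≤ c i + τ * d i) ∧ ∃ i, d i < 0 ∧ c i + τ * d i = 0 := by
  classical
  obtain ⟨i₀, hi₀⟩ := hd
  obtain ⟨i, hi, hmin⟩ := Finset.exists_min_image (Finset.univ.filter fun i => d i < 0)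
    (fun i => c i / -d i) ⟨i₀, by simpa using hi₀⟩
  simp only [Finset.mem_filter, Finset.mem_univ, true_and] at hi hmin
  have hτ : 0 ≤ c i / -d i := div_nonneg (hc i) (by linarith)
  refine ⟨c i / -d i, hτ, fun k => ?_, i, hi, ?_⟩
  · rcases lt_or_ge (d k) 0 with hk | hk
    · have := hmin k hk
      rw [le_div_iff₀ (by linarith)] at this
      linarith
    · have := mul_nonneg hτ hk
      linarith [hc k]
  · have := hi.ne
    field_simp
    ring

/-- The closed triangle with vertices `a`, `b`, `c`, in barycentric coordinates. -/
def triangle (a b c : Fin 2 → ℝ) : Set (Fin 2 → ℝ) :=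
  {x | ∃ α β γ : ℝ, 0 ≤ α ∧ 0 ≤ β ∧ 0 ≤ γ ∧ α + β + γ = 1 ∧ α • a + β • b + γ • c = x}

theorem Convex.triangle_subset {P : Set (Fin 2 → ℝ)} (hP : Convex ℝ P) {a b c : Fin 2 → ℝ}
    (ha : a ∈ P) (hb : b ∈ P) (hc : c ∈ P) : triangle a b c ⊆ P := by
  rintro x ⟨α, β, γ, hα, hβ, hγ, hs, rfl⟩
  have := hP.sum_mem (t := Finset.univ) (w := ![α, β, γ]) (z := ![a, b, c])
    (by intro i _; fin_cases i <;> simpa) (by simp [Fin.sum_univ_three, hs])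
    (by intro i _; fin_cases i <;> simpa)
  simpa [Fin.sum_univ_three] using this

/-- A lattice triangle of normalized area at least two contains a lattice point besides its
vertices. -/
theorem exists_lattice_point_of_two_le {a b c : Fin 2 → ℤ} (h : 2 ≤ cross (b - a) (c - a)) :
    ∃ (r : Fin 2 → ℤ) (α β γ : ℝ), 0 ≤ α ∧ 0 ≤ β ∧ 0 ≤ γ ∧ α < 1 ∧ β < 1 ∧ γ < 1 ∧ α + β + γ = 1 ∧
      α • castVec a + β • castVec b + γ • castVec c = castVec r := by
  rcases exists_multiple_or_complement h with ⟨g, u₀, hg, hu⟩ | ⟨w, j, hj0, hjD, hw, huw⟩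
  · have hgR : (2 : ℝ) ≤ g := by exact_mod_cast hg
    have hg1 : (1 / g : ℝ) < 1 := by rw [div_lt_one (by linarith)]; linarith
    have hg0 : (0 : ℝ) < 1 / g := by positivity
    refine ⟨a + u₀, 1 - 1 / g, 1 / g, 0, by linarith, hg0.le, le_rfl, by linarith, hg1,
      zero_lt_one, by ring, ?_⟩
    have hb : castVec b = castVec a + (g : ℝ) • castVec u₀ := by
      rw [← castVec_smul, ← hu, castVec_sub]; simp
    have : castVec u₀ = ((1 / g : ℝ) * g) • castVec u₀ := by
      rw [one_div_mul_cancel (by linarith), one_smul]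
    rw [castVec_add, this, hb]; module
  · set D := cross (b - a) (c - a)
    have hDR : (2 : ℝ) ≤ D := by exact_mod_cast h
    have hjR : (j : ℝ) + 1 ≤ D := by exact_mod_cast hjD
    have hj0R : (0 : ℝ) ≤ j := by exact_mod_cast hj0
    have h1 : ((j : ℝ) + 1) / D ≤ 1 := by rw [div_le_one (by linarith)]; exact hjR
    have h2 : (j : ℝ) / D < 1 := by rw [div_lt_one (by linarith)]; linarith
    have h3 : (1 : ℝ) / D < 1 := by rw [div_lt_one (by linarith)]; linarith
    have h4 : (0 : ℝ) < ((j : ℝ) + 1) / D := by positivity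
    -- These weights rewrite `D • w = v + j • u` barycentrically; the first is nonnegative because
    -- `j < D`.
    refine ⟨a + w, 1 - ((j : ℝ) + 1) / D, (j : ℝ) / D, 1 / D, by linarith, by positivity,
      by positivity, by linarith, h2, h3, by ring, ?_⟩
    have hwR : (D : ℝ) • castVec w = castVec c - castVec a + (j : ℝ) • (castVec b - castVec a) := by
      rw [← castVec_smul, hw, castVec_add, castVec_smul, castVec_sub, castVec_sub]
    have : castVec w = (1 / D : ℝ) • ((D : ℝ) • castVec w) := by
      rw [smul_smul, one_div_mul_cancel (by linarith), one_smul]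
    rw [castVec_add, this, hwR]; module

theorem exists_lattice_point_of_two_le_abs {a b c : Fin 2 → ℤ}
    (h : 2 ≤ |cross (b - a) (c - a)|) :
    ∃ (r : Fin 2 → ℤ) (α β γ : ℝ), 0 ≤ α ∧ 0 ≤ β ∧ 0 ≤ γ ∧ α < 1 ∧ β < 1 ∧ γ < 1 ∧ α + β + γ = 1 ∧
      α • castVec a + β • castVec b + γ • castVec c = castVec r := by
  rcases le_abs.1 h with h | h
  · exact exists_lattice_point_of_two_le h
  · rw [← cross_swap] at h
    obtain ⟨r, α, β, γ, h1, h2, h3, h4, h5, h6, h7, h8⟩ := exists_lattice_point_of_two_le h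
    exact ⟨r, α, γ, β, h1, h3, h2, h4, h6, h5, by linarith, by rw [← h8]; abel⟩

theorem natAbs_lt_of_eq_mul {m n : ℤ} {θ : ℝ} (h0 : 0 < θ) (h1 : θ < 1) (hn : n ≠ 0)
    (h : (m : ℝ) = θ * n) : m.natAbs < n.natAbs ∧ m ≠ 0 := by
  have hn' : (n : ℝ) ≠ 0 := by exact_mod_cast hn
  constructor
  · zify
    have h2 : |(m : ℝ)| < |(n : ℝ)| := by
      rw [h, abs_mul, abs_of_pos h0]
      exact mul_lt_of_lt_one_left (abs_pos.2 hn') h1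
    exact_mod_cast h2
  · rintro rfl
    rw [Int.cast_zero, eq_comm, mul_eq_zero] at h
    exact h.elim h0.ne' hn'

/-- Every point of a nondegenerate lattice triangle lies in a unimodular lattice triangle. -/
theorem exists_unimodular_triangle {P : Set (Fin 2 → ℝ)} (hP : Convex ℝ P) {x : Fin 2 → ℝ}
    (n : ℕ) : ∀ a b c : Fin 2 → ℤ, castVec a ∈ P → castVec b ∈ P → castVec c ∈ P →
      (cross (b - a) (c - a)).natAbs = n → cross (b - a) (c - a) ≠ 0 →
      x ∈ triangle (castVec a) (castVec b) (castVec c) →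
      ∃ a b c : Fin 2 → ℤ, castVec a ∈ P ∧ castVec b ∈ P ∧ castVec c ∈ P ∧
        IsUnit (cross (b - a) (c - a)) ∧ x ∈ triangle (castVec a) (castVec b) (castVec c) := by
  induction n using Nat.strong_induction_on with
  | _ n ih =>
  intro a b c ha hb hc hn hne hx
  by_cases h1 : n = 1
  · exact ⟨a, b, c, ha, hb, hc, Int.isUnit_iff_natAbs_eq.2 (hn.trans h1), hx⟩
  have h2 : 2 ≤ |cross (b - a) (c - a)| := by
    have : (cross (b - a) (c - a)).natAbs ≠ 0 := by simpa using hne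
    rw [Int.abs_eq_natAbs]
    omega
  obtain ⟨r, ρ₀, ρ₁, ρ₂, h0, h1, h2, h0', h1', h2', hs, hr⟩ := exists_lattice_point_of_two_le_abs h2
  have hrP : castVec r ∈ P := hP.triangle_subset ha hb hc ⟨ρ₀, ρ₁, ρ₂, h0, h1, h2, hs, hr⟩
  obtain ⟨α, β, γ, hα, hβ, hγ, hsx, hx⟩ := hx
  -- Subtracting `τ` times the weights of `r` until one weight vanishes puts `x` in the triangle
  -- with that vertex replaced by `r`. The weight of `r` there is nonzero and is the ratio of the
  -- areas.
  obtain ⟨τ, hτ, hpos, i, hi, hi0⟩ := exists_ratio (c := ![α, β, γ]) (d := ![-ρ₀, -ρ₁, -ρ₂])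
    (by intro i; fin_cases i <;> simpa) (by
      by_contra! hcon
      have e0 := hcon 0
      have e1 := hcon 1
      have e2 := hcon 2
      simp at e0 e1 e2
      linarith)
  have p0 := hpos 0
  have p1 := hpos 1
  have p2 := hpos 2
  simp at p0 p1 p2
  have hr0 := congrFun hr 0
  have hr1 := congrFun hr 1
  simp [castVec] at hr0 hr1
  have hρ : ρ₀ = 1 - ρ₁ - ρ₂ := by linarith
  subst hρ
  have harea : ∀ {y z w : Fin 2 → ℤ} {θ : ℝ}, castVec y ∈ P → castVec z ∈ P → castVec w ∈ P →
      0 < θ → θ < 1 →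
      ((cross (z - y) (w - y) : ℤ) : ℝ) = θ * (cross (b - a) (c - a) : ℤ) →
      x ∈ triangle (castVec y) (castVec z) (castVec w) →
      ∃ a b c : Fin 2 → ℤ, castVec a ∈ P ∧ castVec b ∈ P ∧ castVec c ∈ P ∧
        IsUnit (cross (b - a) (c - a)) ∧ x ∈ triangle (castVec a) (castVec b) (castVec c) := by
    intro y z w θ hy hz hw hθ0 hθ1 hθ hxt
    obtain ⟨h3, h4⟩ := natAbs_lt_of_eq_mul hθ0 hθ1 hne hθ
    exact ih _ (hn ▸ h3) y z w hy hz hw rfl h4 hxt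
  fin_cases i
  · simp at hi hi0
    refine harea hrP hb hc (θ := 1 - ρ₁ - ρ₂) (by linarith) h0' ?_
      ⟨τ, β - τ * ρ₁, γ - τ * ρ₂, hτ, by linarith, by linarith, by linarith, ?_⟩
    · simp only [cross, Pi.sub_apply]; push_cast; rw [← hr0, ← hr1]; ring
    · rw [← hx, ← hr, show α = τ * (1 - ρ₁ - ρ₂) by linarith]; module
  · simp at hi hi0
    refine harea ha hrP hc (θ := ρ₁) (by linarith) h1' ?_
      ⟨α - τ * (1 - ρ₁ - ρ₂), τ, γ - τ * ρ₂, by linarith, hτ, by linarith, by linarith, ?_⟩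
    · simp only [cross, Pi.sub_apply]; push_cast; rw [← hr0, ← hr1]; ring
    · rw [← hx, ← hr, show β = τ * ρ₁ by linarith]; module
  · simp at hi hi0
    refine harea ha hb hrP (θ := ρ₂) (by linarith) h2' ?_
      ⟨α - τ * (1 - ρ₁ - ρ₂), β - τ * ρ₁, τ, by linarith, by linarith, hτ, by linarith, ?_⟩
    · simp only [cross, Pi.sub_apply]; push_cast; rw [← hr0, ← hr1]; ring
    · rw [← hx, ← hr, show γ = τ * ρ₂ by linarith]; module

/-- A ray starting in a nondegenerate triangle leaves it through a side transversal to it. -/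
theorem exists_exit {b : Fin 3 → Fin 2 → ℝ} (hb : cross (b 1 - b 0) (b 2 - b 0) ≠ 0)
    {q u : Fin 2 → ℝ} (hq : q ∈ triangle (b 0) (b 1) (b 2)) (hu : u ≠ 0) :
    ∃ τ : ℝ, 0 ≤ τ ∧ ∃ i k : Fin 3, ∃ μ : ℝ, 0 ≤ μ ∧ μ ≤ 1 ∧
      q + τ • u = b i + μ • (b k - b i) ∧ cross u (b k - b i) ≠ 0 := by
  obtain ⟨α, β, γ, hα, hβ, hγ, hs, hq⟩ := hq
  set D := cross (b 1 - b 0) (b 2 - b 0) with hD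
  set d₁ := cross u (b 2 - b 0) / D with hd₁
  set d₂ := cross (b 1 - b 0) u / D with hd₂
  have hud : u = d₁ • (b 1 - b 0) + d₂ • (b 2 - b 0) := by
    have h1 := cross_smul_eq (b 1 - b 0) (b 2 - b 0) u
    have h2 : u = (1 / D) • (D • u) := by rw [smul_smul, one_div_mul_cancel hb, one_smul]
    rw [h1] at h2
    rw [hd₁, hd₂]
    nth_rw 1 [h2]
    module
  -- The barycentric velocities of the ray sum to zero and do not all vanish.
  have hex : ∃ i, (![-d₁ - d₂, d₁, d₂] : Fin 3 → ℝ) i < 0 := by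
    by_contra! hcon
    have e0 := hcon 0
    have e1 := hcon 1
    have e2 := hcon 2
    simp at e0 e1 e2
    have h1 : d₁ = 0 := by linarith
    have h2 : d₂ = 0 := by linarith
    apply hu
    rw [hud, h1, h2]; simp
  obtain ⟨τ, hτ, hpos, i, hi, hi0⟩ := exists_ratio (c := ![α, β, γ])
    (by intro i; fin_cases i <;> simpa) hex
  have p0 := hpos 0
  have p1 := hpos 1
  have p2 := hpos 2
  simp at p0 p1 p2
  have c1 : cross u (b 2 - b 0) = d₁ * D := by rw [hd₁]; field_simp
  have c2 : cross u (b 1 - b 0) = -d₂ * D := by rw [cross_swap, hd₂]; field_simp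
  have hα' : α = 1 - β - γ := by linarith
  refine ⟨τ, hτ, ?_⟩
  fin_cases i
  · simp at hi hi0
    refine ⟨1, 2, γ + τ * d₂, p2, by linarith, ?_, ?_⟩
    · have h1 : β = 1 - γ - τ * d₂ - τ * d₁ := by linarith
      have h2 : α = τ * d₁ + τ * d₂ := by linarith
      rw [← hq, h1, h2]
      nth_rw 1 [hud]
      module
    · have : b 2 - b 1 = (b 2 - b 0) - (b 1 - b 0) := by abel
      rw [this, cross_sub_right _ (b 2 - b 0), c1, c2]
      have : d₁ * D - -d₂ * D = (d₁ + d₂) * D := by ring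
      rw [this]
      exact mul_ne_zero (by linarith) hb
  · simp at hi hi0
    refine ⟨0, 2, γ + τ * d₂, p2, by linarith, ?_, ?_⟩
    · have h1 : β = - τ * d₁ := by linarith
      rw [← hq, hα', h1]
      nth_rw 1 [hud]
      module
    · rw [c1]
      exact mul_ne_zero hi.ne hb
  · simp at hi hi0
    refine ⟨0, 1, β + τ * d₁, p1, by linarith, ?_, ?_⟩
    · have h1 : γ = - τ * d₂ := by linarith
      rw [← hq, hα', h1]
      nth_rw 1 [hud]
      module
    · rw [c2]
      exact mul_ne_zero (by linarith) hb

/-! ### Carathéodory's theorem in the plane -/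

theorem collinear_of_cross {S : Set (Fin 2 → ℝ)}
    (h : ∀ a ∈ S, ∀ b ∈ S, ∀ c ∈ S, cross (b - a) (c - a) = 0) : Collinear ℝ S := by
  by_cases hS : S.Subsingleton
  · rcases hS.eq_empty_or_singleton with rfl | ⟨a, rfl⟩
    · exact collinear_empty ℝ _
    · exact collinear_singleton ℝ _
  rw [Set.not_subsingleton_iff] at hS
  obtain ⟨a, ha, b, hb, hab⟩ := hS
  rw [collinear_iff_of_mem ha]
  refine ⟨b - a, fun c hc => ?_⟩
  have h0 := h a ha b hb c hc
  have h1 : (b - a) 0 ≠ 0 ∨ (b - a) 1 ≠ 0 := by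
    by_contra! hcon
    apply hab
    ext i
    fin_cases i
    · exact (sub_eq_zero.1 hcon.1).symm
    · exact (sub_eq_zero.1 hcon.2).symm
  rw [cross] at h0
  rcases h1 with h1 | h1
  · refine ⟨(c - a) 0 / (b - a) 0, ?_⟩
    rw [vadd_eq_add, ← sub_eq_iff_eq_add]
    ext i
    fin_cases i
    · simp only [Fin.zero_eta, Pi.smul_apply, smul_eq_mul]; field_simp
    · simp only [Fin.mk_one, Pi.smul_apply, smul_eq_mul]; field_simp; linarith
  · refine ⟨(c - a) 1 / (b - a) 1, ?_⟩
    rw [vadd_eq_add, ← sub_eq_iff_eq_add]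
    ext i
    fin_cases i
    · simp only [Fin.zero_eta, Pi.smul_apply, smul_eq_mul]; field_simp; linarith
    · simp only [Fin.mk_one, Pi.smul_apply, smul_eq_mul]; field_simp

/-- Carathéodory's theorem in the plane, sorted by the number of points used. -/
theorem mem_convexHull_plane {S : Set (Fin 2 → ℝ)} {x : Fin 2 → ℝ} (hx : x ∈ convexHull ℝ S) :
    x ∈ S ∨ (∃ a ∈ S, ∃ b ∈ S, a ≠ b ∧ ∃ μ : ℝ, 0 ≤ μ ∧ μ ≤ 1 ∧ x = a + μ • (b - a)) ∨
      ∃ a ∈ S, ∃ b ∈ S, ∃ c ∈ S, cross (b - a) (c - a) ≠ 0 ∧ x ∈ triangle a b c := by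
  classical
  rw [convexHull_eq_union] at hx
  simp only [Set.mem_iUnion, exists_prop] at hx
  obtain ⟨t, htS, hai, hxt⟩ := hx
  have hcard : t.card ≤ 3 := by
    have := hai.card_le_finrank_succ
    rw [Fintype.card_coe] at this
    have h2 : Module.finrank ℝ (vectorSpan ℝ (Set.range ((↑) : t → Fin 2 → ℝ))) ≤ 2 := by
      simpa using Submodule.finrank_le (vectorSpan ℝ (Set.range ((↑) : t → Fin 2 → ℝ)))
    omega
  obtain h | h | h | h : t.card = 0 ∨ t.card = 1 ∨ t.card = 2 ∨ t.card = 3 := by omega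
  · rw [Finset.card_eq_zero] at h
    simp [h] at hxt
  · obtain ⟨a, rfl⟩ := Finset.card_eq_one.1 h
    left
    have : x = a := by simpa using hxt
    rw [this]
    exact htS (by simp)
  · right; left
    obtain ⟨a, b, hab, rfl⟩ := Finset.card_eq_two.1 h
    refine ⟨a, htS (by simp), b, htS (by simp), hab, ?_⟩
    rw [Finset.coe_pair, convexHull_pair, segment_eq_image'] at hxt
    obtain ⟨μ, hμ, rfl⟩ := hxt
    exact ⟨μ, hμ.1, hμ.2, rfl⟩
  · right; right
    have hnc : ¬ Collinear ℝ (t : Set (Fin 2 → ℝ)) := by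
      rw [collinear_iff_finrank_le_one]
      have := hai.finrank_vectorSpan (n := 2) (by simp [h])
      have hr : Set.range ((↑) : t → Fin 2 → ℝ) = t := Subtype.range_coe
      rw [hr] at this
      omega
    have hex : ∃ a ∈ t, ∃ b ∈ t, ∃ c ∈ t, cross (b - a) (c - a) ≠ 0 := by
      by_contra! hcon
      exact hnc (collinear_of_cross hcon)
    obtain ⟨a, ha, b, hb, c, hc, hne⟩ := hex
    have hab : a ≠ b := by rintro rfl; simp [cross] at hne
    have hac : a ≠ c := by rintro rfl; simp [cross] at hne
    have hbc : b ≠ c := by rintro rfl; simp [cross_vec_self] at hne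
    have ht : ({a, b, c} : Finset (Fin 2 → ℝ)) = t := by
      apply Finset.eq_of_subset_of_card_le
      · intro y hy
        simp only [Finset.mem_insert, Finset.mem_singleton] at hy
        rcases hy with rfl | rfl | rfl <;> assumption
      · rw [h, Finset.card_eq_three.2 ⟨a, b, c, hab, hac, hbc, rfl⟩]
    refine ⟨a, htS ha, b, htS hb, c, htS hc, hne, ?_⟩
    rw [← ht] at hxt
    simp only [Finset.coe_insert, Finset.coe_singleton] at hxt
    rw [convexHull_insert (by simp), convexHull_pair, mem_convexJoin] at hxt
    obtain ⟨y, hy, z, ⟨α, β, hα, hβ, hs, rfl⟩, γ, δ, hγ, hδ, hs', rfl⟩ := hxt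
    rw [Set.mem_singleton_iff] at hy
    subst hy
    exact ⟨γ, δ * α, δ * β, hγ, by positivity, by positivity, by
      rw [add_assoc, ← mul_add, hs]; linarith, by module⟩

/-- In a planar set that is not collinear, every point of the convex hull lies in a nondegenerate
triangle. -/
theorem mem_triangle_of_mem_convexHull {S : Set (Fin 2 → ℝ)} {x : Fin 2 → ℝ}
    (hS : ∃ a ∈ S, ∃ b ∈ S, ∃ c ∈ S, cross (b - a) (c - a) ≠ 0) (hx : x ∈ convexHull ℝ S) :
    ∃ a ∈ S, ∃ b ∈ S, ∃ c ∈ S, cross (b - a) (c - a) ≠ 0 ∧ x ∈ triangle a b c := by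
  -- This repairs the degenerate outcomes of Carathéodory's theorem: a missing vertex is taken from
  -- `S` off the given line and receives weight zero.
  have hext : ∀ a ∈ S, ∀ b ∈ S, a ≠ b → ∃ c ∈ S, cross (b - a) (c - a) ≠ 0 := by
    intro a ha b hb hab
    by_contra! hcon
    have hcol : Collinear ℝ S := by
      apply collinear_of_cross
      intro p hp q hq r hr
      have e1 := hcon p hp
      have e2 := hcon q hq
      have e3 := hcon r hr
      by_contra hne
      have hpq := cross_smul_eq (q - p) (r - p) (b - a)
      have e4 : cross (b - a) (q - p) = 0 := by
        rw [show q - p = (q - a) - (p - a) by abel, cross_sub_right _ (q - a), e1, e2, sub_zero]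
      have e5 : cross (b - a) (r - p) = 0 := by
        rw [show r - p = (r - a) - (p - a) by abel, cross_sub_right _ (r - a), e1, e3, sub_zero]
      rw [e5, cross_swap (q - p) (b - a), e4, neg_zero, zero_smul, zero_smul, add_zero, smul_eq_zero] at hpq
      rcases hpq with h | h
      · exact hne h
      · exact hab (sub_eq_zero.1 h).symm
    obtain ⟨p, hp, q, hq, r, hr, hne⟩ := hS
    rw [collinear_iff_of_mem hp] at hcol
    obtain ⟨v, hv⟩ := hcol
    obtain ⟨s, rfl⟩ := hv q hq
    obtain ⟨t, rfl⟩ := hv r hr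
    apply hne
    simp [cross]; ring
  rcases mem_convexHull_plane hx with h | ⟨a, ha, b, hb, hab, μ, h0, h1, rfl⟩ | h
  · obtain ⟨b, hb, hxb⟩ : ∃ b ∈ S, x ≠ b := by
      by_contra! hcon
      obtain ⟨p, hp, q, hq, r, hr, hne⟩ := hS
      rw [← hcon p hp, ← hcon q hq] at hne
      simp [cross] at hne
    obtain ⟨c, hc, hne⟩ := hext x h b hb hxb
    exact ⟨x, h, b, hb, c, hc, hne, 1, 0, 0, by simp⟩
  · obtain ⟨c, hc, hne⟩ := hext a ha b hb hab
    exact ⟨a, ha, b, hb, c, hc, hne, 1 - μ, μ, 0, by linarith, h0, le_rfl, by ring, by module⟩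
  · exact h

/-! ### Coordinates on the Cayley sum and the three types of simplices -/

/-- The point of `R³` above the planar point `x` at height `t`. -/
def atHeight {R : Type*} (x : Fin 2 → R) (t : R) : Fin 3 → R := ![x 0, x 1, t]

theorem snoc_eq_atHeight (x : Fin 2 → ℝ) (t : ℝ) : (Fin.snoc x t : Fin (2 + 1) → ℝ) = atHeight x t := by
  ext i
  fin_cases i <;> rfl

theorem castVec_atHeight (z : Fin 2 → ℤ) (n : ℤ) : castVec (atHeight z n) = atHeight (castVec z) n := by
  ext i
  fin_cases i <;> rfl

theorem cayleySum_eq (P Q : Set (Fin 2 → ℝ)) : cayleySum P Q =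
    convexHull ℝ ((fun x => atHeight x (0 : ℝ)) '' P ∪ (fun x => atHeight x (1 : ℝ)) '' Q) := by
  simp only [cayleySum, snoc_eq_atHeight]

theorem convex_cayleySum (P Q : Set (Fin 2 → ℝ)) : Convex ℝ (cayleySum P Q) := convex_convexHull _ _

theorem atHeight_zero_mem_cayleySum {P Q : Set (Fin 2 → ℝ)} {p : Fin 2 → ℝ} (hp : p ∈ P) :
    atHeight p (0 : ℝ) ∈ cayleySum P Q :=
  cayleySum_eq P Q ▸ subset_convexHull ℝ _ (Or.inl ⟨p, hp, rfl⟩)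

theorem atHeight_one_mem_cayleySum {P Q : Set (Fin 2 → ℝ)} {q : Fin 2 → ℝ} (hq : q ∈ Q) :
    atHeight q (1 : ℝ) ∈ cayleySum P Q :=
  cayleySum_eq P Q ▸ subset_convexHull ℝ _ (Or.inr ⟨q, hq, rfl⟩)

theorem convex_image_atHeight {P : Set (Fin 2 → ℝ)} (hP : Convex ℝ P) (t : ℝ) :
    Convex ℝ ((fun x => atHeight x t) '' P) := by
  rintro _ ⟨x, hx, rfl⟩ _ ⟨y, hy, rfl⟩ a b ha hb hab
  refine ⟨a • x + b • y, hP hx hy ha hb hab, ?_⟩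
  ext i
  fin_cases i
  · simp [atHeight]
  · simp [atHeight]
  · simp [atHeight, ← add_mul, hab]

theorem mem_cayleySum_iff {P Q : Set (Fin 2 → ℝ)} (hP : Convex ℝ P) (hQ : Convex ℝ Q)
    (hPne : P.Nonempty) (hQne : Q.Nonempty) {X : Fin 3 → ℝ} :
    X ∈ cayleySum P Q ↔ ∃ p ∈ P, ∃ q ∈ Q, ∃ t : ℝ, 0 ≤ t ∧ t ≤ 1 ∧
      X = atHeight ((1 - t) • p + t • q) t := by
  have key : ∀ (p q : Fin 2 → ℝ) (t : ℝ), atHeight ((1 - t) • p + t • q) t =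
      (1 - t) • atHeight p 0 + t • atHeight q 1 := by
    intro p q t
    ext i
    fin_cases i <;> simp [atHeight]
  constructor
  · intro h
    rw [cayleySum_eq, convexHull_union (hPne.image _) (hQne.image _),
      (convex_image_atHeight hP 0).convexHull_eq, (convex_image_atHeight hQ 1).convexHull_eq,
      mem_convexJoin] at h
    obtain ⟨_, ⟨p, hp, rfl⟩, _, ⟨q, hq, rfl⟩, s, t, hs, ht, hst, rfl⟩ := h
    refine ⟨p, hp, q, hq, t, ht, by linarith, ?_⟩
    rw [key, ← hst]
    simp
  · rintro ⟨p, hp, q, hq, t, h0, h1, rfl⟩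
    rw [key]
    exact convex_cayleySum P Q (atHeight_zero_mem_cayleySum hp) (atHeight_one_mem_cayleySum hq)
      (by linarith) h0 (by ring)

/-- `x` lies in a unimodular simplex contained in `C`. -/
def InUnimodularSimplex {d : ℕ} (C : Set (Fin d → ℝ)) (x : Fin d → ℝ) : Prop :=
  ∃ T, IsUnimodularSimplex T ∧ T ⊆ C ∧ x ∈ T

theorem hasUnimodularCover_of_forall {d : ℕ} {C : Set (Fin d → ℝ)}
    (h : ∀ x ∈ C, InUnimodularSimplex C x) : HasUnimodularCover C := by
  refine ⟨{T | IsUnimodularSimplex T ∧ T ⊆ C}, fun T hT => hT.1, ?_⟩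
  apply Set.Subset.antisymm
  · exact Set.sUnion_subset fun T hT => hT.2
  · intro x hx
    obtain ⟨T, h1, h2, h3⟩ := h x hx
    exact ⟨T, ⟨h1, h2⟩, h3⟩

theorem inUnimodularSimplex_sum {d : ℕ} {C : Set (Fin d → ℝ)} (hC : Convex ℝ C)
    (v : Fin (d + 1) → Fin d → ℤ) (hdet : IsUnit (Matrix.of fun i : Fin d => v i.succ - v 0).det)
    (hv : ∀ k, castVec (v k) ∈ C) (c : Fin (d + 1) → ℝ) (hc : ∀ k, 0 ≤ c k) (hs : ∑ k, c k = 1) :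
    InUnimodularSimplex C (∑ k, c k • castVec (v k)) := by
  have hb := (Module.Basis.is_basis_iff_det (Pi.basisFun ℤ (Fin d))
    (v := fun i : Fin d => v i.succ - v 0)).2 (by rwa [Pi.basisFun_det_apply])
  refine ⟨convexHull ℝ (Set.range fun k => castVec (v k)),
    ⟨v, Module.Basis.mk hb.1 hb.2.ge, fun i => by simp, rfl⟩, ?_, ?_⟩
  · exact convexHull_min (by rintro _ ⟨k, rfl⟩; exact hv k) hC
  · exact (convex_convexHull ℝ _).sum_mem (fun k _ => hc k) hs
      fun k _ => subset_convexHull ℝ _ ⟨k, rfl⟩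

section Builders

variable {P Q : Set (Fin 2 → ℝ)}

theorem inUnimodularSimplex_point_triangle {p a b c : Fin 2 → ℤ} (hp : castVec p ∈ P)
    (ha : castVec a ∈ Q) (hb : castVec b ∈ Q) (hc : castVec c ∈ Q)
    (hu : IsUnit (cross (b - a) (c - a))) {q : Fin 2 → ℝ}
    (hq : q ∈ triangle (castVec a) (castVec b) (castVec c)) {t : ℝ} (h0 : 0 ≤ t) (h1 : t ≤ 1) :
    InUnimodularSimplex (cayleySum P Q) (atHeight ((1 - t) • castVec p + t • q) t) := by
  obtain ⟨α, β, γ, hα, hβ, hγ, hs, rfl⟩ := hq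
  have := inUnimodularSimplex_sum (convex_cayleySum P Q)
    ![atHeight p 0, atHeight a 1, atHeight b 1, atHeight c 1]
    (by
      convert hu using 1
      rw [Matrix.det_fin_three]
      simp [atHeight, cross, Fin.succ]
      ring)
    (by
      intro k
      fin_cases k
      · simpa [castVec_atHeight] using atHeight_zero_mem_cayleySum hp
      · simpa [castVec_atHeight] using atHeight_one_mem_cayleySum ha
      · simpa [castVec_atHeight] using atHeight_one_mem_cayleySum hb
      · simpa [castVec_atHeight] using atHeight_one_mem_cayleySum hc)
    ![1 - t, t * α, t * β, t * γ]
    (by intro k; fin_cases k <;> simp <;> first | linarith | positivity)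
    (by simp [Fin.sum_univ_four]; linear_combination t * hs)
  convert this using 1
  ext i
  fin_cases i <;> simp [Fin.sum_univ_four, atHeight, castVec]
  · ring
  · ring
  · linear_combination -t * hs

theorem inUnimodularSimplex_triangle_point {q a b c : Fin 2 → ℤ} (hq : castVec q ∈ Q)
    (ha : castVec a ∈ P) (hb : castVec b ∈ P) (hc : castVec c ∈ P)
    (hu : IsUnit (cross (b - a) (c - a))) {p : Fin 2 → ℝ}
    (hp : p ∈ triangle (castVec a) (castVec b) (castVec c)) {t : ℝ} (h0 : 0 ≤ t) (h1 : t ≤ 1) :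
    InUnimodularSimplex (cayleySum P Q) (atHeight ((1 - t) • p + t • castVec q) t) := by
  obtain ⟨α, β, γ, hα, hβ, hγ, hs, rfl⟩ := hp
  have h1' : 0 ≤ 1 - t := by linarith
  have := inUnimodularSimplex_sum (convex_cayleySum P Q)
    ![atHeight q 1, atHeight a 0, atHeight b 0, atHeight c 0]
    (by
      -- Edges from the apex at height `1` have last coordinate `-1`, so the determinant is minus
      -- the planar cross product.
      rw [← IsUnit.neg_iff]
      convert hu using 1
      rw [Matrix.det_fin_three]
      simp [atHeight, cross, Fin.succ]
      ring)
    (by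
      intro k
      fin_cases k
      · simpa [castVec_atHeight] using atHeight_one_mem_cayleySum hq
      · simpa [castVec_atHeight] using atHeight_zero_mem_cayleySum ha
      · simpa [castVec_atHeight] using atHeight_zero_mem_cayleySum hb
      · simpa [castVec_atHeight] using atHeight_zero_mem_cayleySum hc)
    ![t, (1 - t) * α, (1 - t) * β, (1 - t) * γ]
    (by intro k; fin_cases k <;> simp <;> first | linarith | positivity)
    (by simp [Fin.sum_univ_four]; linear_combination (1 - t) * hs)
  convert this using 1
  ext i
  fin_cases i <;> simp [Fin.sum_univ_four, atHeight, castVec]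
  · ring
  · ring

theorem inUnimodularSimplex_segment_segment {p₁ p₂ q₁ q₂ : Fin 2 → ℤ} (hp₁ : castVec p₁ ∈ P)
    (hp₂ : castVec p₂ ∈ P) (hq₁ : castVec q₁ ∈ Q) (hq₂ : castVec q₂ ∈ Q)
    (hu : IsUnit (cross (p₂ - p₁) (q₂ - q₁))) {t : ℝ} (h0 : 0 ≤ t) (h1 : t ≤ 1)
    {κ μ : ℝ} (hκ0 : 0 ≤ κ) (hκ1 : κ ≤ 1) (hμ0 : 0 ≤ μ) (hμ1 : μ ≤ 1) :
    InUnimodularSimplex (cayleySum P Q) (atHeight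
      ((1 - t) • (castVec p₁ + κ • (castVec p₂ - castVec p₁)) +
        t • (castVec q₁ + μ • (castVec q₂ - castVec q₁))) t) := by
  have h1' : 0 ≤ 1 - t := by linarith
  have hκ1' : 0 ≤ 1 - κ := by linarith
  have hμ1' : 0 ≤ 1 - μ := by linarith
  have := inUnimodularSimplex_sum (convex_cayleySum P Q)
    ![atHeight p₁ 0, atHeight p₂ 0, atHeight q₁ 1, atHeight q₂ 1]
    (by
      rw [← IsUnit.neg_iff]
      convert hu using 1
      rw [Matrix.det_fin_three]
      simp [atHeight, cross, Fin.succ]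
      ring)
    (by
      intro k
      fin_cases k
      · simpa [castVec_atHeight] using atHeight_zero_mem_cayleySum hp₁
      · simpa [castVec_atHeight] using atHeight_zero_mem_cayleySum hp₂
      · simpa [castVec_atHeight] using atHeight_one_mem_cayleySum hq₁
      · simpa [castVec_atHeight] using atHeight_one_mem_cayleySum hq₂)
    ![(1 - t) * (1 - κ), (1 - t) * κ, t * (1 - μ), t * μ]
    (by intro k; fin_cases k <;> simp <;> positivity)
    (by simp [Fin.sum_univ_four]; ring)
  convert this using 1
  ext i
  fin_cases i <;> simp [Fin.sum_univ_four, atHeight, castVec] <;> ring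

end Builders

/-! ### Transferring displacements between the summands -/

section Exchange

variable {B : Set (Fin 2 → ℝ)} {H : (Fin 2 → ℝ) → Prop} {α β : ℝ}

/-- Move the second summand parallel to `a₂ - a₁` onto `[b₁, r]` and compensate in the first. If the
first stays in `[a₁, a₂]`, the point lies in the smaller cell; if it would leave, stop at `a₁` or
`a₂`, and convexity keeps the second summand in `B`. -/
theorem exchange_cut_half (hB : Convex ℝ B) (hα : 0 ≤ α) (hβ : 0 ≤ β)
    {a₁ a₂ b₁ b₂ r : Fin 2 → ℝ} (hb₁ : b₁ ∈ B) (hb₂ : b₂ ∈ B) (hrB : r ∈ B) {θ c : ℝ} (hθ0 : 0 < θ)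
    (hθ1 : θ ≤ 1) (hr : r = b₁ + θ • (b₂ - b₁) + c • (a₂ - a₁))
    (h1 : c ≠ 0 → ∀ b ∈ B, H (α • a₁ + β • b)) (h2 : c ≠ 0 → ∀ b ∈ B, H (α • a₂ + β • b))
    (h3 : ∀ κ μ : ℝ, 0 ≤ κ → κ ≤ 1 → 0 ≤ μ → μ ≤ 1 →
      H (α • (a₁ + κ • (a₂ - a₁)) + β • (b₁ + μ • (r - b₁))))
    {κ μ : ℝ} (hκ0 : 0 ≤ κ) (hκ1 : κ ≤ 1) (hμ0 : 0 ≤ μ) (hμ1 : μ ≤ θ) :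
    H (α • (a₁ + κ • (a₂ - a₁)) + β • (b₁ + μ • (b₂ - b₁))) := by
  set ν := μ / θ with hν
  have hν0 : 0 ≤ ν := by positivity
  have hν1 : ν ≤ 1 := (div_le_one hθ0).2 hμ1
  have hμν : μ = ν * θ := by rw [hν, div_mul_cancel₀ _ hθ0.ne']
  have hend : b₁ + ν • (r - b₁) = b₁ + μ • (b₂ - b₁) + (ν * c) • (a₂ - a₁) := by
    rw [hr, hμν]; module
  have hendB : b₁ + μ • (b₂ - b₁) + (ν * c) • (a₂ - a₁) ∈ B := by
    rw [← hend]; exact hB.add_smul_sub_mem hb₁ hrB ⟨hν0, hν1⟩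
  have hstB : b₁ + μ • (b₂ - b₁) ∈ B := hB.add_smul_sub_mem hb₁ hb₂ ⟨hμ0, hμ1.trans hθ1⟩
  -- Here `r` lies on `[b₁, b₂]` and no sliding is needed. Requiring `h1`, `h2` only for `c ≠ 0`
  -- admits a set `B` that is a mere segment.
  by_cases hc : c = 0
  · have := h3 κ ν hκ0 hκ1 hν0 hν1
    rw [hend, hc] at this
    simpa using this
  rcases hα.eq_or_lt with rfl | hα
  · have := h1 hc _ hstB
    simpa using this
  by_cases hlow : κ - β / α * (ν * c) < 0
  · have hlow' : α / β * κ ≤ ν * c ∧ 0 < β := by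
      rcases hβ.eq_or_lt with rfl | hβ
      · simp at hlow; linarith
      · refine ⟨?_, hβ⟩
        have : κ < β / α * (ν * c) := by linarith
        rw [div_mul_eq_mul_div, div_le_iff₀ hβ]
        rw [div_mul_eq_mul_div, lt_div_iff₀ hα] at this
        linarith
    have := h1 hc _ (hB.add_smul_mem_of_le hstB hendB (τ := α / β * κ) (by positivity) hlow'.1)
    convert this using 1
    rw [smul_add β (b₁ + _), smul_smul β, ← mul_assoc, mul_div_cancel₀ _ hlow'.2.ne']
    module
  by_cases hhigh : 1 < κ - β / α * (ν * c)
  · have hhigh' : α / β * (1 - κ) ≤ -(ν * c) ∧ 0 < β := by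
      rcases hβ.eq_or_lt with rfl | hβ
      · simp at hhigh; linarith
      · refine ⟨?_, hβ⟩
        have : 1 - κ < β / α * (-(ν * c)) := by linarith
        rw [div_mul_eq_mul_div, div_le_iff₀ hβ]
        rw [div_mul_eq_mul_div, lt_div_iff₀ hα] at this
        linarith
    have hendB' : b₁ + μ • (b₂ - b₁) + (-(ν * c)) • (a₁ - a₂) ∈ B := by
      convert hendB using 1; module
    have := h2 hc _ (hB.add_smul_mem_of_le hstB hendB' (τ := α / β * (1 - κ))
      (mul_nonneg (by positivity) (by linarith)) hhigh'.1)
    convert this using 1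
    rw [smul_add β (b₁ + _), smul_smul β, ← mul_assoc, mul_div_cancel₀ _ hhigh'.2.ne']
    module
  push Not at hlow hhigh
  have := h3 _ ν hlow hhigh hν0 hν1
  convert this using 1
  have e : α * (κ - β / α * (ν * c)) = α * κ - β * (ν * c) := by field_simp
  rw [hend, smul_add α a₁ ((κ - _) • _), smul_smul α (κ - _), e]
  module

/-- Refining a mixed cell `[a₁, a₂] + [b₁, b₂]` by a point `r` in the strip spanned by `[b₁, b₂]`
in direction `a₂ - a₁`. -/
theorem exchange_cut (hB : Convex ℝ B) (hα : 0 ≤ α) (hβ : 0 ≤ β)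
    {a₁ a₂ b₁ b₂ r : Fin 2 → ℝ} (hb₁ : b₁ ∈ B) (hb₂ : b₂ ∈ B) (hrB : r ∈ B) {θ c : ℝ} (hθ0 : 0 < θ)
    (hθ1 : θ < 1) (hr : r = b₁ + θ • (b₂ - b₁) + c • (a₂ - a₁))
    (h1 : c ≠ 0 → ∀ b ∈ B, H (α • a₁ + β • b)) (h2 : c ≠ 0 → ∀ b ∈ B, H (α • a₂ + β • b))
    (h3 : ∀ κ μ : ℝ, 0 ≤ κ → κ ≤ 1 → 0 ≤ μ → μ ≤ 1 →
      H (α • (a₁ + κ • (a₂ - a₁)) + β • (b₁ + μ • (r - b₁))))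
    (h4 : ∀ κ μ : ℝ, 0 ≤ κ → κ ≤ 1 → 0 ≤ μ → μ ≤ 1 →
      H (α • (a₁ + κ • (a₂ - a₁)) + β • (b₂ + μ • (r - b₂))))
    {κ μ : ℝ} (hκ0 : 0 ≤ κ) (hκ1 : κ ≤ 1) (hμ0 : 0 ≤ μ) (hμ1 : μ ≤ 1) :
    H (α • (a₁ + κ • (a₂ - a₁)) + β • (b₁ + μ • (b₂ - b₁))) := by
  rcases le_total μ θ with h | h
  · exact exchange_cut_half hB hα hβ hb₁ hb₂ hrB hθ0 hθ1.le hr h1 h2 h3 hκ0 hκ1 hμ0 h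
  · have := exchange_cut_half hB hα hβ hb₂ hb₁ hrB (θ := 1 - θ) (c := c) (by linarith)
      (by linarith) (by rw [hr]; module) h1 h2 h4 hκ0 hκ1 (μ := 1 - μ) (by linarith) (by linarith)
    convert this using 1
    module

/-- A point of `α • [a₁, a₂] + β • B` can be moved to a mixed cell or to a translate of `B`. -/
theorem exchange_segment (hB : Convex ℝ B) (hα : 0 < α) (hβ : 0 < β) {a₁ a₂ : Fin 2 → ℝ}
    (ha : a₁ ≠ a₂) {b : Fin 3 → Fin 2 → ℝ} (hbB : ∀ i, b i ∈ B)
    (hb : cross (b 1 - b 0) (b 2 - b 0) ≠ 0) {q : Fin 2 → ℝ} (hq : q ∈ triangle (b 0) (b 1) (b 2))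
    (h1 : ∀ y ∈ B, H (α • a₁ + β • y))
    (h2 : ∀ i k, cross (a₂ - a₁) (b k - b i) ≠ 0 → ∀ κ μ : ℝ, 0 ≤ κ → κ ≤ 1 → 0 ≤ μ → μ ≤ 1 →
      H (α • (a₁ + κ • (a₂ - a₁)) + β • (b i + μ • (b k - b i))))
    {κ : ℝ} (hκ0 : 0 ≤ κ) (hκ1 : κ ≤ 1) :
    H (α • (a₁ + κ • (a₂ - a₁)) + β • q) := by
  -- Sliding `q` along `a₂ - a₁` while pulling the first summand towards `a₁` ends at `a₁` or on a
  -- transversal side, whichever comes first.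
  obtain ⟨τ, hτ, i, k, μ, hμ0, hμ1, hexit, hne⟩ := exists_exit hb hq (sub_ne_zero.2 ha.symm)
  have hqB : q ∈ B := hB.triangle_subset (hbB 0) (hbB 1) (hbB 2) hq
  have hexB : q + τ • (a₂ - a₁) ∈ B := by
    rw [hexit]; exact hB.add_smul_sub_mem (hbB i) (hbB k) ⟨hμ0, hμ1⟩
  rcases le_total (α / β * κ) τ with h | h
  · have := h1 _ (hB.add_smul_mem_of_le hqB hexB (τ := α / β * κ) (by positivity) h)
    convert this using 1
    rw [smul_add β q, smul_smul β, ← mul_assoc, mul_div_cancel₀ _ hβ.ne']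
    module
  · have hlow : 0 ≤ κ - β / α * τ := by
      rw [sub_nonneg, div_mul_eq_mul_div, div_le_iff₀ hα]
      rw [div_mul_eq_mul_div, le_div_iff₀ hβ] at h
      linarith
    have hhigh : κ - β / α * τ ≤ 1 := by
      have : 0 ≤ β / α * τ := by positivity
      linarith
    have := h2 i k hne _ μ hlow hhigh hμ0 hμ1
    convert this using 1
    have e : α * (κ - β / α * τ) = α * κ - β * τ := by field_simp
    rw [← hexit, smul_add α a₁ ((κ - _) • _), smul_smul α (κ - _), e]
    module

end Exchange

/-! ### Lattice points and lattice triangles in polytopes -/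

/-- `P` contains a nondegenerate lattice triangle. -/
def HasLatticeTriangle (P : Set (Fin 2 → ℝ)) : Prop :=
  ∃ a b c : Fin 2 → ℤ, castVec a ∈ P ∧ castVec b ∈ P ∧ castVec c ∈ P ∧ cross (b - a) (c - a) ≠ 0

theorem cross_castVec_sub_ne_zero {a b c d : Fin 2 → ℤ} :
    cross (castVec b - castVec a) (castVec d - castVec c) ≠ 0 ↔ cross (b - a) (d - c) ≠ 0 := by
  rw [← castVec_sub, ← castVec_sub, cross_castVec, Int.cast_ne_zero]

theorem IsLatticePolytope.eq_convexHull_inter {d : ℕ} {P : Set (Fin d → ℝ)}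
    (hP : IsLatticePolytope P) : P = convexHull ℝ (P ∩ latticePoints d) := by
  apply Set.Subset.antisymm
  · obtain ⟨S, -, -, hSL, rfl⟩ := hP
    exact convexHull_mono fun s hs => ⟨subset_convexHull ℝ S hs, hSL hs⟩
  · exact convexHull_min Set.inter_subset_left hP.convex

theorem IsLatticePolytope.exists_castVec_mem {d : ℕ} {P : Set (Fin d → ℝ)}
    (hP : IsLatticePolytope P) : ∃ p, castVec p ∈ P := by
  obtain ⟨S, -, ⟨s, hs⟩, hSL, rfl⟩ := hP
  obtain ⟨p, rfl⟩ := hSL hs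
  exact ⟨p, subset_convexHull ℝ S hs⟩

theorem IsLatticePolytope.mem_cases {P : Set (Fin 2 → ℝ)} (hP : IsLatticePolytope P)
    {x : Fin 2 → ℝ} (hx : x ∈ P) : (∃ p, castVec p = x) ∨
      (∃ a b : Fin 2 → ℤ, castVec a ∈ P ∧ castVec b ∈ P ∧ a ≠ b ∧
        ∃ μ : ℝ, 0 ≤ μ ∧ μ ≤ 1 ∧ x = castVec a + μ • (castVec b - castVec a)) ∨
      HasLatticeTriangle P := by
  rw [hP.eq_convexHull_inter] at hx
  rcases mem_convexHull_plane hx with h | ⟨a, ⟨ha, a, rfl⟩, b, ⟨hb, b, rfl⟩, hab, h⟩ |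
    ⟨a, ⟨ha, a, rfl⟩, b, ⟨hb, b, rfl⟩, c, ⟨hc, c, rfl⟩, hne, -⟩
  · exact Or.inl h.2
  · exact Or.inr (Or.inl ⟨a, b, ha, hb, fun h => hab (by rw [h]), h⟩)
  · exact Or.inr (Or.inr ⟨a, b, c, ha, hb, hc, cross_castVec_sub_ne_zero.1 hne⟩)

theorem HasLatticeTriangle.exists_triangle {P : Set (Fin 2 → ℝ)} (h : HasLatticeTriangle P)
    (hP : IsLatticePolytope P) {x : Fin 2 → ℝ} (hx : x ∈ P) :
    ∃ a b c : Fin 2 → ℤ, castVec a ∈ P ∧ castVec b ∈ P ∧ castVec c ∈ P ∧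
      cross (b - a) (c - a) ≠ 0 ∧ x ∈ triangle (castVec a) (castVec b) (castVec c) := by
  rw [hP.eq_convexHull_inter] at hx
  obtain ⟨a, b, c, ha, hb, hc, hne⟩ := h
  obtain ⟨a, ⟨ha, a, rfl⟩, b, ⟨hb, b, rfl⟩, c, ⟨hc, c, rfl⟩, hne, h⟩ :=
    mem_triangle_of_mem_convexHull (S := P ∩ latticePoints 2) ⟨castVec a, ⟨ha, a, rfl⟩, castVec b, ⟨hb, b, rfl⟩, castVec c,
      ⟨hc, c, rfl⟩, cross_castVec_sub_ne_zero.2 hne⟩ hx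
  exact ⟨a, b, c, ha, hb, hc, cross_castVec_sub_ne_zero.1 hne, h⟩

theorem IsLatticePolygon.hasLatticeTriangle {Q : Set (Fin 2 → ℝ)} (hQ : IsLatticePolygon Q) :
    HasLatticeTriangle Q := by
  by_contra hcon
  have hcol : Collinear ℝ (Q ∩ latticePoints 2) := by
    apply collinear_of_cross
    rintro _ ⟨ha, a, rfl⟩ _ ⟨hb, b, rfl⟩ _ ⟨hc, c, rfl⟩
    by_contra hne
    exact hcon ⟨a, b, c, ha, hb, hc, cross_castVec_sub_ne_zero.1 hne⟩
  rw [collinear_iff_finrank_le_one, ← direction_affineSpan, ← affineSpan_convexHull,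
    ← hQ.1.eq_convexHull_inter, direction_affineSpan, hQ.2] at hcol
  omega

/-! ### Covering the Cayley sum -/

section Cover

variable {P Q : Set (Fin 2 → ℝ)}

theorem inUnimodularSimplex_of_castVec_left (hQ : IsLatticePolytope Q) (hQT : HasLatticeTriangle Q)
    {t : ℝ} (h0 : 0 ≤ t) (h1 : t ≤ 1) {p : Fin 2 → ℤ} (hp : castVec p ∈ P) {q : Fin 2 → ℝ}
    (hq : q ∈ Q) : InUnimodularSimplex (cayleySum P Q) (atHeight ((1 - t) • castVec p + t • q) t) := by
  obtain ⟨a, b, c, ha, hb, hc, hne, hx⟩ := hQT.exists_triangle hQ hq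
  obtain ⟨a, b, c, ha, hb, hc, hu, hx⟩ :=
    exists_unimodular_triangle hQ.convex _ a b c ha hb hc rfl hne hx
  exact inUnimodularSimplex_point_triangle hp ha hb hc hu hx h0 h1

theorem inUnimodularSimplex_of_castVec_right (hP : IsLatticePolytope P) (hPT : HasLatticeTriangle P)
    {t : ℝ} (h0 : 0 ≤ t) (h1 : t ≤ 1) {q : Fin 2 → ℤ} (hq : castVec q ∈ Q) {p : Fin 2 → ℝ}
    (hp : p ∈ P) : InUnimodularSimplex (cayleySum P Q) (atHeight ((1 - t) • p + t • castVec q) t) := by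
  obtain ⟨a, b, c, ha, hb, hc, hne, hx⟩ := hPT.exists_triangle hP hp
  obtain ⟨a, b, c, ha, hb, hc, hu, hx⟩ :=
    exists_unimodular_triangle hP.convex _ a b c ha hb hc rfl hne hx
  exact inUnimodularSimplex_triangle_point hq ha hb hc hu hx h0 h1

/-- Strong induction on the absolute cross product: `exists_strip_point` cuts the cell into two of
smaller nonzero determinant, and `exchange_cut` covers the points that slide out of them. -/
theorem inUnimodularSimplex_of_segments (hP : IsLatticePolytope P) (hQ : IsLatticePolytope Q)
    (hQT : HasLatticeTriangle Q) (hPQ : IsWeakMinkowskiSummand P Q) {t : ℝ} (h0 : 0 ≤ t)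
    (h1 : t ≤ 1) (n : ℕ) : ∀ p₁ p₂ q₁ q₂ : Fin 2 → ℤ, castVec p₁ ∈ P → castVec p₂ ∈ P →
      castVec q₁ ∈ Q → castVec q₂ ∈ Q → (cross (p₂ - p₁) (q₂ - q₁)).natAbs = n →
      cross (p₂ - p₁) (q₂ - q₁) ≠ 0 → ∀ κ μ : ℝ, 0 ≤ κ → κ ≤ 1 → 0 ≤ μ → μ ≤ 1 →
      InUnimodularSimplex (cayleySum P Q) (atHeight
        ((1 - t) • (castVec p₁ + κ • (castVec p₂ - castVec p₁)) +
          t • (castVec q₁ + μ • (castVec q₂ - castVec q₁))) t) := by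
  induction n using Nat.strong_induction_on with
  | _ n ih =>
  intro p₁ p₂ q₁ q₂ hp₁ hp₂ hq₁ hq₂ hn hne κ μ hκ0 hκ1 hμ0 hμ1
  by_cases hn1 : n = 1
  · exact inUnimodularSimplex_segment_segment hp₁ hp₂ hq₁ hq₂
      (Int.isUnit_iff_natAbs_eq.2 (hn.trans hn1)) h0 h1 hκ0 hκ1 hμ0 hμ1
  have h2 : 2 ≤ |cross (p₂ - p₁) (q₂ - q₁)| := by
    have : (cross (p₂ - p₁) (q₂ - q₁)).natAbs ≠ 0 := by simpa using hne
    rw [Int.abs_eq_natAbs]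
    omega
  have hneR : cross (castVec p₂ - castVec p₁) (castVec q₂ - castVec q₁) ≠ 0 :=
    cross_castVec_sub_ne_zero.2 hne
  have hcr : ∀ a b c d : Fin 2 → ℤ, ((cross (b - a) (d - c) : ℤ) : ℝ) =
      cross (castVec b - castVec a) (castVec d - castVec c) := fun a b c d => by
    rw [← castVec_sub, ← castVec_sub, cross_castVec]
  set D := cross (castVec p₂ - castVec p₁) (castVec q₂ - castVec q₁) with hD
  have h1' : 0 ≤ 1 - t := by linarith
  have hdiv : ∀ z : Fin 2 → ℝ,
      z = (cross z (castVec q₂ - castVec q₁) / D) • (castVec p₂ - castVec p₁) +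
        (cross (castVec p₂ - castVec p₁) z / D) • (castVec q₂ - castVec q₁) := fun z => by
    have e1 := cross_smul_eq (castVec p₂ - castVec p₁) (castVec q₂ - castVec q₁) z
    have e2 : z = (1 / D) • (D • z) := by rw [smul_smul, one_div_mul_cancel hneR, one_smul]
    rw [← hD] at e1
    rw [e1] at e2
    nth_rw 1 [e2]
    module
  rcases exists_strip_point hP hQ hPQ hp₁ hp₂ hq₁ hq₂ h2 with
    ⟨r, hr, θ, hθ0, hθ1, hθ⟩ | ⟨r, hr, θ, hθ0, hθ1, hθ⟩
  · have hθ' : ((cross (r - p₂) (q₂ - q₁) : ℤ) : ℝ) = -((1 - θ) * (cross (p₂ - p₁) (q₂ - q₁) : ℤ)) := by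
      have : r - p₂ = (r - p₁) - (p₂ - p₁) := by abel
      rw [this, cross_sub_left]; push_cast; rw [hθ]; ring
    obtain ⟨e1, e1'⟩ := natAbs_lt_of_eq_mul hθ0 hθ1 hne hθ
    obtain ⟨e2, e2'⟩ := natAbs_lt_of_eq_mul (m := -cross (r - p₂) (q₂ - q₁)) (θ := 1 - θ)
      (by linarith) (by linarith) hne (by push_cast; rw [hθ']; ring)
    rw [Int.natAbs_neg] at e2
    rw [neg_ne_zero] at e2'
    have hrd := hdiv (castVec r - castVec p₁)
    rw [← hcr, hθ, hcr, ← hD, mul_div_cancel_right₀ _ hneR] at hrd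
    set c := cross (castVec p₂ - castVec p₁) (castVec r - castVec p₁) / D with hc
    -- When `r` is off the line through `p₁` and `p₂`, these three points already form the triangle
    -- needed to treat `P` as two-dimensional.
    have hPT : c ≠ 0 → HasLatticeTriangle P := fun hc0 =>
      ⟨p₁, p₂, r, hp₁, hp₂, hr, cross_castVec_sub_ne_zero.1 fun hz => hc0 (by rw [hc, hz, zero_div])⟩
    have := exchange_cut (H := fun x => InUnimodularSimplex (cayleySum P Q) (atHeight x t))
      hP.convex h0 h1' hp₁ hp₂ hr hθ0 hθ1
      (a₁ := castVec q₁) (a₂ := castVec q₂) (c := c)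
      (by rw [← sub_add_cancel (castVec r) (castVec p₁), hrd]; abel)
      (fun hc0 b hb => by
        rw [add_comm (_ : Fin 2 → ℝ)]; exact inUnimodularSimplex_of_castVec_right hP (hPT hc0) h0 h1 hq₁ hb)
      (fun hc0 b hb => by
        rw [add_comm (_ : Fin 2 → ℝ)]; exact inUnimodularSimplex_of_castVec_right hP (hPT hc0) h0 h1 hq₂ hb)
      (fun κ μ h1 h2 h3 h4 => by
        rw [add_comm (_ : Fin 2 → ℝ)]
        exact ih _ (hn ▸ e1) p₁ r q₁ q₂ hp₁ hr hq₁ hq₂ rfl e1' μ κ h3 h4 h1 h2)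
      (fun κ μ h1 h2 h3 h4 => by
        rw [add_comm (_ : Fin 2 → ℝ)]
        exact ih _ (hn ▸ e2) p₂ r q₁ q₂ hp₂ hr hq₁ hq₂ rfl e2' μ κ h3 h4 h1 h2)
      hμ0 hμ1 hκ0 hκ1
    rwa [add_comm (_ : Fin 2 → ℝ)] at this
  · have hθ' : ((cross (p₂ - p₁) (r - q₂) : ℤ) : ℝ) = -((1 - θ) * (cross (p₂ - p₁) (q₂ - q₁) : ℤ)) := by
      have : r - q₂ = (r - q₁) - (q₂ - q₁) := by abel
      rw [this, cross_sub_right _ (r - q₁)]; push_cast; rw [hθ]; ring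
    obtain ⟨e1, e1'⟩ := natAbs_lt_of_eq_mul hθ0 hθ1 hne hθ
    obtain ⟨e2, e2'⟩ := natAbs_lt_of_eq_mul (m := -cross (p₂ - p₁) (r - q₂)) (θ := 1 - θ)
      (by linarith) (by linarith) hne (by push_cast; rw [hθ']; ring)
    rw [Int.natAbs_neg] at e2
    rw [neg_ne_zero] at e2'
    have hrd := hdiv (castVec r - castVec q₁)
    rw [← hcr p₁ p₂ q₁ r, hθ, hcr, ← hD, mul_div_cancel_right₀ _ hneR] at hrd
    exact exchange_cut (H := fun x => InUnimodularSimplex (cayleySum P Q) (atHeight x t))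
      hQ.convex h1' h0 hq₁ hq₂ hr hθ0 hθ1
      (a₁ := castVec p₁) (a₂ := castVec p₂)
      (by rw [← sub_add_cancel (castVec r) (castVec q₁), hrd]; abel)
      (fun _ b hb => inUnimodularSimplex_of_castVec_left hQ hQT h0 h1 hp₁ hb)
      (fun _ b hb => inUnimodularSimplex_of_castVec_left hQ hQT h0 h1 hp₂ hb)
      (fun κ μ h1 h2 h3 h4 =>
        ih _ (hn ▸ e1) p₁ p₂ q₁ r hp₁ hp₂ hq₁ hr rfl e1' κ μ h1 h2 h3 h4)
      (fun κ μ h1 h2 h3 h4 =>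
        ih _ (hn ▸ e2) p₁ p₂ q₂ r hp₁ hp₂ hq₂ hr rfl e2' κ μ h1 h2 h3 h4)
      hκ0 hκ1 hμ0 hμ1

theorem inUnimodularSimplex_of_segment_left (hP : IsLatticePolytope P) (hQ : IsLatticePolytope Q)
    (hQT : HasLatticeTriangle Q) (hPQ : IsWeakMinkowskiSummand P Q) {t : ℝ} (h0 : 0 < t)
    (h1 : t < 1) {p₁ p₂ : Fin 2 → ℤ} (hp₁ : castVec p₁ ∈ P) (hp₂ : castVec p₂ ∈ P) (hp : p₁ ≠ p₂)
    {κ : ℝ} (hκ0 : 0 ≤ κ) (hκ1 : κ ≤ 1) {q : Fin 2 → ℝ} (hq : q ∈ Q) :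
    InUnimodularSimplex (cayleySum P Q) (atHeight
      ((1 - t) • (castVec p₁ + κ • (castVec p₂ - castVec p₁)) + t • q) t) := by
  obtain ⟨a, b, c, ha, hb, hc, hne, hx⟩ := hQT.exists_triangle hQ hq
  let z : Fin 3 → Fin 2 → ℤ := ![a, b, c]
  have hz : ∀ i, castVec (z i) ∈ Q := by intro i; fin_cases i <;> simpa [z]
  exact exchange_segment (H := fun x => InUnimodularSimplex (cayleySum P Q) (atHeight x t))
    hQ.convex (by linarith) h0 (castVec_injective.ne hp) (b := fun i => castVec (z i)) hz
    (cross_castVec_sub_ne_zero.2 hne) hx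
    (fun y hy => inUnimodularSimplex_of_castVec_left hQ hQT h0.le h1.le hp₁ hy)
    (fun i k hik => inUnimodularSimplex_of_segments hP hQ hQT hPQ h0.le h1.le _ p₁ p₂ (z i) (z k)
      hp₁ hp₂ (hz i) (hz k) rfl (cross_castVec_sub_ne_zero.1 hik)) hκ0 hκ1

theorem inUnimodularSimplex_of_segment_right (hP : IsLatticePolytope P) (hQ : IsLatticePolytope Q)
    (hPT : HasLatticeTriangle P) (hQT : HasLatticeTriangle Q) (hPQ : IsWeakMinkowskiSummand P Q)
    {t : ℝ} (h0 : 0 < t) (h1 : t < 1) {q₁ q₂ : Fin 2 → ℤ} (hq₁ : castVec q₁ ∈ Q)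
    (hq₂ : castVec q₂ ∈ Q) (hq : q₁ ≠ q₂) {μ : ℝ} (hμ0 : 0 ≤ μ) (hμ1 : μ ≤ 1) {p : Fin 2 → ℝ}
    (hp : p ∈ P) :
    InUnimodularSimplex (cayleySum P Q) (atHeight
      ((1 - t) • p + t • (castVec q₁ + μ • (castVec q₂ - castVec q₁))) t) := by
  obtain ⟨a, b, c, ha, hb, hc, hne, hx⟩ := hPT.exists_triangle hP hp
  let z : Fin 3 → Fin 2 → ℤ := ![a, b, c]
  have hz : ∀ i, castVec (z i) ∈ P := by intro i; fin_cases i <;> simpa [z]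
  rw [add_comm (_ : Fin 2 → ℝ)]
  exact exchange_segment (H := fun x => InUnimodularSimplex (cayleySum P Q) (atHeight x t))
    hP.convex h0 (by linarith) (castVec_injective.ne hq) (b := fun i => castVec (z i)) hz
    (cross_castVec_sub_ne_zero.2 hne) hx
    (fun y hy => by
      rw [add_comm (_ : Fin 2 → ℝ)]; exact inUnimodularSimplex_of_castVec_right hP hPT h0.le h1.le hq₁ hy)
    (fun i k hik κ μ h2 h3 h4 h5 => by
      rw [add_comm (_ : Fin 2 → ℝ)]
      refine inUnimodularSimplex_of_segments hP hQ hQT hPQ h0.le h1.le _ (z i) (z k) q₁ q₂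
        (hz i) (hz k) hq₁ hq₂ rfl (cross_castVec_sub_ne_zero.1 ?_) μ κ h4 h5 h2 h3
      rw [cross_swap]
      exact neg_ne_zero.2 hik) hμ0 hμ1

theorem HasLatticeTriangle.exists_exit {Q : Set (Fin 2 → ℝ)} (h : HasLatticeTriangle Q)
    (hQ : IsLatticePolytope Q) {q u : Fin 2 → ℝ} (hq : q ∈ Q) (hu : u ≠ 0) :
    ∃ τ : ℝ, 0 ≤ τ ∧ ∃ q₁ q₂ : Fin 2 → ℤ, castVec q₁ ∈ Q ∧ castVec q₂ ∈ Q ∧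
      ∃ μ : ℝ, 0 ≤ μ ∧ μ ≤ 1 ∧ q + τ • u = castVec q₁ + μ • (castVec q₂ - castVec q₁) ∧
        cross u (castVec q₂ - castVec q₁) ≠ 0 := by
  obtain ⟨a, b, c, ha, hb, hc, hne, hx⟩ := h.exists_triangle hQ hq
  let z : Fin 3 → Fin 2 → ℤ := ![a, b, c]
  have hz : ∀ i, castVec (z i) ∈ Q := by intro i; fin_cases i <;> simpa [z]
  obtain ⟨τ, hτ, i, k, μ, h0, h1, h2, h3⟩ := _root_.exists_exit (b := fun i => castVec (z i))
    (cross_castVec_sub_ne_zero.2 hne) hx hu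
  exact ⟨τ, hτ, z i, z k, hz i, hz k, μ, h0, h1, h2, h3⟩

/-- Slide `p` and `q` in opposite directions with equal weighted speed until one of them first
reaches a lattice segment; the direction is arbitrary. -/
theorem inUnimodularSimplex_of_hasLatticeTriangle (hP : IsLatticePolytope P)
    (hQ : IsLatticePolytope Q) (hPT : HasLatticeTriangle P) (hQT : HasLatticeTriangle Q)
    (hPQ : IsWeakMinkowskiSummand P Q) {t : ℝ} (h0 : 0 < t) (h1 : t < 1) {p q : Fin 2 → ℝ}
    (hp : p ∈ P) (hq : q ∈ Q) :
    InUnimodularSimplex (cayleySum P Q) (atHeight ((1 - t) • p + t • q) t) := by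
  set u : Fin 2 → ℝ := ![1, 0]
  have hu : u ≠ 0 := fun h => by simpa [u] using congrFun h 0
  obtain ⟨τ, hτ, p₁, p₂, hp₁, hp₂, κ, hκ0, hκ1, hpe, hpne⟩ := hPT.exists_exit hP hp hu
  obtain ⟨σ, hσ, q₁, q₂, hq₁, hq₂, μ, hμ0, hμ1, hqe, hqne⟩ :=
    hQT.exists_exit hQ hq (neg_ne_zero.2 hu)
  have hp12 : p₁ ≠ p₂ := by rintro rfl; simp [cross] at hpne
  have hq12 : q₁ ≠ q₂ := by rintro rfl; simp [cross] at hqne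
  have hpeP : p + τ • u ∈ P := by
    rw [hpe]; exact hP.convex.add_smul_sub_mem hp₁ hp₂ ⟨hκ0, hκ1⟩
  have hqeQ : q + σ • (-u) ∈ Q := by
    rw [hqe]; exact hQ.convex.add_smul_sub_mem hq₁ hq₂ ⟨hμ0, hμ1⟩
  have h1' : 0 < 1 - t := by linarith
  rcases le_total ((1 - t) / t * τ) σ with h | h
  · have h2 := hQ.convex.add_smul_mem_of_le hq hqeQ (τ := (1 - t) / t * τ) (by positivity) h
    have := inUnimodularSimplex_of_segment_left hP hQ hQT hPQ h0 h1 hp₁ hp₂ hp12 hκ0 hκ1 h2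
    convert this using 2
    have e : t * ((1 - t) / t * τ) = (1 - t) * τ := by field_simp
    rw [← hpe, smul_add t q, smul_smul t, e]
    module
  · have h3 : t / (1 - t) * σ ≤ τ := by
      rw [div_mul_eq_mul_div, div_le_iff₀ h1']
      rw [div_mul_eq_mul_div, le_div_iff₀ h0] at h
      linarith
    have h2 := hP.convex.add_smul_mem_of_le hp hpeP (τ := t / (1 - t) * σ) (by positivity) h3
    have := inUnimodularSimplex_of_segment_right hP hQ hPT hQT hPQ h0 h1 hq₁ hq₂ hq12 hμ0 hμ1 h2
    convert this using 2
    have e : (1 - t) * (t / (1 - t) * σ) = t * σ := by field_simp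
    rw [← hqe, smul_add (1 - t) p, smul_smul (1 - t), e]
    module

theorem inUnimodularSimplex_cayleySum (hP : IsLatticePolytope P) (hQ : IsLatticePolytope Q)
    (hQT : HasLatticeTriangle Q) (hPQ : IsWeakMinkowskiSummand P Q) {t : ℝ} (h0 : 0 ≤ t)
    (h1 : t ≤ 1) {p q : Fin 2 → ℝ} (hp : p ∈ P) (hq : q ∈ Q) :
    InUnimodularSimplex (cayleySum P Q) (atHeight ((1 - t) • p + t • q) t) := by
  obtain ⟨p', hp'⟩ := hP.exists_castVec_mem
  obtain ⟨q', hq'⟩ := hQ.exists_castVec_mem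
  rcases h1.eq_or_lt with rfl | h1
  · simpa using inUnimodularSimplex_of_castVec_left hQ hQT h0 le_rfl hp' hq
  rcases h0.eq_or_lt with rfl | h0
  · rcases hP.mem_cases hp with ⟨p, rfl⟩ | ⟨p₁, p₂, hp₁, hp₂, hne, κ, hκ0, hκ1, rfl⟩ | hPT
    · exact inUnimodularSimplex_of_castVec_left hQ hQT h0 h1.le hp hq
    -- At height `0` only a transversal lattice segment of `Q` is needed to complete `[p₁, p₂]` to a
    -- mixed cell; the point of `Q` has weight zero.
    · obtain ⟨-, -, q₁, q₂, hq₁, hq₂, -, -, -, -, hcr⟩ := hQT.exists_exit hQ hq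
        (sub_ne_zero.2 (castVec_injective.ne hne.symm))
      simpa using inUnimodularSimplex_of_segments hP hQ hQT hPQ h0 h1.le _ p₁ p₂ q₁ q₂ hp₁ hp₂
        hq₁ hq₂ rfl (cross_castVec_sub_ne_zero.1 hcr) κ 0 hκ0 hκ1 le_rfl zero_le_one
    · simpa using inUnimodularSimplex_of_castVec_right hP hPT h0 h1.le hq' hp
  rcases hP.mem_cases hp with ⟨p, rfl⟩ | ⟨p₁, p₂, hp₁, hp₂, hne, κ, hκ0, hκ1, rfl⟩ | hPT
  · exact inUnimodularSimplex_of_castVec_left hQ hQT h0.le h1.le hp hq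
  · exact inUnimodularSimplex_of_segment_left hP hQ hQT hPQ h0 h1 hp₁ hp₂ hne hκ0 hκ1 hq
  · exact inUnimodularSimplex_of_hasLatticeTriangle hP hQ hPT hQT hPQ h0 h1 hp hq

end Cover

/-! ### From the cover to integer decomposition -/

theorem exists_weights_of_mem_convexHull_range {ι E : Type*} [Fintype ι] [AddCommGroup E]
    [Module ℝ E] {y : ι → E} {x : E} (hx : x ∈ convexHull ℝ (Set.range y)) :
    ∃ w : ι → ℝ, (∀ k, 0 ≤ w k) ∧ ∑ k, w k = 1 ∧ ∑ k, w k • y k = x := by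
  classical
  have hc : Convex ℝ (Fintype.linearCombination ℝ y '' stdSimplex ℝ ι) :=
    (convex_stdSimplex ℝ ι).linear_image _
  obtain ⟨w, hw, rfl⟩ := convexHull_min (by
    rintro _ ⟨k, rfl⟩
    exact ⟨Pi.single k 1, single_mem_stdSimplex ℝ k, by simp⟩) hc hx
  exact ⟨w, hw.1, hw.2, (Fintype.linearCombination_apply ℝ y w).symm⟩

theorem castVec_sum {d : ℕ} {ι : Type*} (s : Finset ι) (f : ι → Fin d → ℤ) :
    castVec (∑ k ∈ s, f k) = ∑ k ∈ s, castVec (f k) := by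
  ext i
  simp [castVec, Finset.sum_apply]

/-- The barycentric coordinates of a lattice point in the `n`-th dilate of a unimodular simplex are
integers. -/
theorem exists_int_weights {d : ℕ} {v : Fin (d + 1) → Fin d → ℤ}
    (b : Module.Basis (Fin d) ℤ (Fin d → ℤ)) (hb : ∀ i : Fin d, v i.succ - v 0 = b i)
    {n : ℕ} {z : Fin d → ℤ} {x : Fin d → ℝ}
    (hx : x ∈ convexHull ℝ (Set.range fun k => castVec (v k))) (hz : castVec z = (n : ℝ) • x) :
    ∃ m : Fin (d + 1) → ℤ, (∀ k, 0 ≤ m k) ∧ ∑ k, m k = n ∧ z = ∑ k, m k • v k := by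
  obtain ⟨w, hw0, hw1, rfl⟩ := exists_weights_of_mem_convexHull_range hx
  have hdiff : castVec (z - (n : ℤ) • v 0) = ∑ i : Fin d, (n * w i.succ) • castVec (b i) := by
    have h1 : castVec (z - (n : ℤ) • v 0) =
        ∑ k, ((n : ℝ) * w k) • (castVec (v k) - castVec (v 0)) := by
      simp only [smul_sub, Finset.sum_sub_distrib, ← Finset.sum_smul, hw1, mul_smul,
        ← Finset.smul_sum, one_smul]
      rw [castVec_sub, castVec_smul, hz]
      simp
    rw [h1, Fin.sum_univ_succ, sub_self, smul_zero, zero_add]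
    exact Finset.sum_congr rfl fun i _ => by rw [← hb, castVec_sub]
  -- The real-linear extensions of the dual basis of `b`, which read off real coefficients although
  -- `b` is only a basis over `ℤ`.
  let φ : Fin d → (Fin d → ℝ) →ₗ[ℝ] ℝ := fun i =>
    Fintype.linearCombination ℝ fun j => ((b.coord i fun k => if j = k then 1 else 0 : ℤ) : ℝ)
  have hφ : ∀ i (y : Fin d → ℤ), φ i (castVec y) = (b.coord i y : ℤ) := fun i y => by
    rw [LinearMap.pi_apply_eq_sum_univ (b.coord i) y]
    simp [φ, Fintype.linearCombination_apply, castVec]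
  have hcoord : ∀ i : Fin d, ((b.coord i (z - (n : ℤ) • v 0) : ℤ) : ℝ) = n * w i.succ := fun i => by
    rw [← hφ, hdiff, map_sum]
    simp only [map_smul, hφ, smul_eq_mul]
    rw [Finset.sum_eq_single i]
    · simp
    · intro j _ hj
      simp [hj]
    · simp
  let m : Fin (d + 1) → ℤ :=
    Fin.cons (n - ∑ i, b.coord i (z - (n : ℤ) • v 0)) fun i => b.coord i (z - (n : ℤ) • v 0)
  have hm : ∀ k, (m k : ℝ) = n * w k := by
    intro k
    refine Fin.cases ?_ (fun i => ?_) k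
    · simp only [m, Fin.cons_zero]
      push_cast
      simp only [hcoord, ← Finset.mul_sum]
      rw [Fin.sum_univ_succ] at hw1
      linear_combination -(n : ℝ) * hw1
    · simp only [m, Fin.cons_succ]
      exact hcoord i
  refine ⟨m, fun k => ?_, ?_, ?_⟩
  · have : (0 : ℝ) ≤ m k := by rw [hm]; exact mul_nonneg n.cast_nonneg (hw0 k)
    exact_mod_cast this
  · have : ((∑ k, m k : ℤ) : ℝ) = n := by
      push_cast
      simp only [hm, ← Finset.mul_sum, hw1, mul_one]
    exact_mod_cast this
  · apply castVec_injective
    rw [hz, castVec_sum, Finset.smul_sum]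
    exact Finset.sum_congr rfl fun k _ => by rw [castVec_smul, hm, mul_smul]

/-- A lattice point of the Cayley sum is a lattice point of `P` at height `0` or one of `Q` at
height `1`. -/
theorem lattice_cases_of_mem_cayleySum {P Q : Set (Fin 2 → ℝ)} (hP : IsLatticePolytope P)
    (hQ : IsLatticePolytope Q) {y : Fin 3 → ℤ} (hy : castVec y ∈ cayleySum P Q) :
    (y 2 = 0 ∧ castVec ![y 0, y 1] ∈ P) ∨ (y 2 = 1 ∧ castVec ![y 0, y 1] ∈ Q) := by
  obtain ⟨p', hp'⟩ := hP.exists_castVec_mem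
  obtain ⟨q', hq'⟩ := hQ.exists_castVec_mem
  obtain ⟨p, hp, q, hq, t, h0, h1, hX⟩ :=
    (mem_cayleySum_iff hP.convex hQ.convex ⟨_, hp'⟩ ⟨_, hq'⟩).1 hy
  have e0 : (y 0 : ℝ) = (1 - t) * p 0 + t * q 0 := by simpa [castVec, atHeight] using congrFun hX 0
  have e1 : (y 1 : ℝ) = (1 - t) * p 1 + t * q 1 := by simpa [castVec, atHeight] using congrFun hX 1
  have e2 : (y 2 : ℝ) = t := by simpa [castVec, atHeight] using congrFun hX 2
  have h0' : 0 ≤ y 2 := by exact_mod_cast e2 ▸ h0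
  have h1' : y 2 ≤ 1 := by exact_mod_cast e2 ▸ h1
  obtain h | h : y 2 = 0 ∨ y 2 = 1 := by omega
  · left
    refine ⟨h, ?_⟩
    have ht : t = 0 := by rw [← e2, h]; simp
    have : castVec ![y 0, y 1] = p := by
      ext i
      fin_cases i <;> simp [castVec, e0, e1, ht]
    rwa [this]
  · right
    refine ⟨h, ?_⟩
    have ht : t = 1 := by rw [← e2, h]; simp
    have : castVec ![y 0, y 1] = q := by
      ext i
      fin_cases i <;> simp [castVec, e0, e1, ht]
    rwa [this]

/-- For a lattice point `z = p + q`, the point `(z, 1)` is twice a point of the Cayley sum at height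
`1/2`. Its integer weights in a covering simplex sum to `2` and have total height `1`, so it is a
vertex over `P` plus a vertex over `Q`. -/
theorem IsIDPPair.of_hasUnimodularCover {P Q : Set (Fin 2 → ℝ)} (hP : IsLatticePolytope P)
    (hQ : IsLatticePolytope Q) (h : HasUnimodularCover (cayleySum P Q)) : IsIDPPair P Q := by
  obtain ⟨𝒯, h𝒯, hU⟩ := h
  apply Set.Subset.antisymm
  · rintro _ ⟨⟨p, hp, q, hq, rfl⟩, z, hz⟩
    change castVec z = p + q at hz
    have hX : atHeight ((1 - (1 / 2 : ℝ)) • p + (1 / 2 : ℝ) • q) (1 / 2) ∈ cayleySum P Q :=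
      (mem_cayleySum_iff hP.convex hQ.convex ⟨p, hp⟩ ⟨q, hq⟩).2
        ⟨p, hp, q, hq, 1 / 2, by norm_num, by norm_num, rfl⟩
    have hTC : ∀ T ∈ 𝒯, T ⊆ cayleySum P Q := fun T hT => hU ▸ Set.subset_sUnion_of_mem hT
    rw [← hU] at hX
    obtain ⟨T, hT, hXT⟩ := hX
    have hTsub := hTC T hT
    obtain ⟨v, b, hb, rfl⟩ := h𝒯 T hT
    have hv : ∀ k, castVec (v k) ∈ cayleySum P Q := fun k =>
      hTsub (subset_convexHull ℝ _ ⟨k, rfl⟩)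
    obtain ⟨m, hm0, hms, hmz⟩ := exists_int_weights b hb (n := 2) (z := atHeight z 1) hXT (by
      rw [castVec_atHeight, hz]
      ext i
      fin_cases i <;> simp [atHeight] <;> ring)
    have hcase := fun k => lattice_cases_of_mem_cayleySum hP hQ (hv k)
    have hh : ∑ k, m k * v k 2 = 1 := by
      have := congrFun hmz 2
      simpa [atHeight, Finset.sum_apply] using this.symm
    push_cast at hms
    obtain ⟨k, hk0, hk⟩ : ∃ k, m k ≠ 0 ∧ v k 2 = 1 := by
      by_contra! hcon
      have : ∑ k, m k * v k 2 = 0 := Finset.sum_eq_zero fun k _ => by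
        by_cases hmk : m k = 0
        · simp [hmk]
        · simp [((hcase k).resolve_right fun h => hcon k hmk h.1).1]
      omega
    obtain ⟨l, hl0, hl⟩ : ∃ l, m l ≠ 0 ∧ v l 2 = 0 := by
      by_contra! hcon
      have : ∑ k, m k * v k 2 = ∑ k, m k := Finset.sum_congr rfl fun k _ => by
        by_cases hmk : m k = 0
        · simp [hmk]
        · simp [((hcase k).resolve_left fun h => hcon k hmk h.1).1]
      rw [this, hms] at hh
      omega
    have hkl : k ≠ l := by intro h; subst h; omega
    -- The weights are at least `1` at `k` and at `l` and sum to `2`, so nothing is left elsewhere.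
    have hmeq : ∀ i, m i - (Pi.single k 1 + Pi.single l 1 : Fin 4 → ℤ) i = 0 := by
      have hnn : ∀ i ∈ Finset.univ, 0 ≤ m i - (Pi.single k 1 + Pi.single l 1 : Fin 4 → ℤ) i := by
        intro i _
        have := hm0 i
        by_cases hik : i = k
        · subst hik
          simp [hkl]; omega
        · by_cases hil : i = l
          · subst hil
            simp [hik]; omega
          · simp [hik, hil, this]
      have hsum : ∑ i, (m i - (Pi.single k 1 + Pi.single l 1 : Fin 4 → ℤ) i) = 0 := by
        rw [Finset.sum_sub_distrib, hms]
        simp [Finset.sum_add_distrib]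
      intro i
      exact (Finset.sum_eq_zero_iff_of_nonneg hnn).1 hsum i (Finset.mem_univ i)
    have hzkl : atHeight z 1 = v k + v l := by
      rw [hmz, Finset.sum_congr rfl fun i _ => by rw [sub_eq_zero.1 (hmeq i)]]
      simp [add_smul, Finset.sum_add_distrib, Pi.single_apply, ite_smul]
    have hlP : castVec ![v l 0, v l 1] ∈ P := ((hcase l).resolve_right fun h => by omega).2
    have hkQ : castVec ![v k 0, v k 1] ∈ Q := ((hcase k).resolve_left fun h => by omega).2
    refine ⟨_, ⟨hlP, _, rfl⟩, _, ⟨hkQ, _, rfl⟩, ?_⟩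
    change castVec _ + castVec _ = p + q
    rw [← hz, ← castVec_add]
    congr 1
    have e0 := congrFun hzkl 0
    have e1 := congrFun hzkl 1
    simp [atHeight] at e0 e1
    ext i
    fin_cases i
    · simp; omega
    · simp; omega
  · rintro _ ⟨_, ⟨hp, p, rfl⟩, _, ⟨hq, q, rfl⟩, rfl⟩
    exact ⟨⟨_, hp, _, hq, rfl⟩, p + q, castVec_add p q⟩

theorem mainTheorem2 (P Q : Set (Fin 2 → ℝ)) (hP : IsLatticePolytope P)
    (hQ : IsLatticePolygon Q) (hPQ : IsWeakMinkowskiSummand P Q) :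
    HasUnimodularCover (cayleySum P Q) ∧ IsIDPPair P Q := by
  have hcover : HasUnimodularCover (cayleySum P Q) := by
    refine hasUnimodularCover_of_forall fun X hX => ?_
    obtain ⟨p', hp'⟩ := hP.exists_castVec_mem
    obtain ⟨q', hq'⟩ := hQ.1.exists_castVec_mem
    obtain ⟨p, hp, q, hq, t, h0, h1, rfl⟩ :=
      (mem_cayleySum_iff hP.convex hQ.1.convex ⟨_, hp'⟩ ⟨_, hq'⟩).1 hX
    exact inUnimodularSimplex_cayleySum hP hQ.1 hQ.hasLatticeTriangle hPQ h0 h1 hp hq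
  exact ⟨hcover, IsIDPPair.of_hasUnimodularCover hP hQ.1 hcover⟩
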